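/- Let $(M,g)$ be an oriented smooth pseudo-Riemannian manifold (of arbitrary signature) of dimension $n\ge 4$, with Hodge star $*$ determined by $\langle\alpha,\beta\rangle\,\mathrm{vol}^g=\alpha\wedge *\beta$ and extended to forms with values in a vector bundle by $*(\omega\otimes C)=(*\omega)\otimes C$. For a smooth 4-form $\Omega$ on $M$ let $B_\Omega$ be the endomorphism field of $\wedge^2T^*M$ (extended to vector-bundle-valued 2-forms in the same way) given by $B_\Omega\,\omega=*(*\Omega\wedge\omega)$. The form $\Omega$ is called appropriate if $B_\Omega$ has a nonzero real constant eigenvalue, that is, there is a real constant $\mu\ne 0$ such that at every point of $M$ there is a nonzero 2-form $\beta$ with $B_\Omega\beta=\mu\beta$. Let $\Omega$ be an appropriate 4-form on $M$, let $\lambda\in\mathbb{R}$, $\lambda\neq 0$, and let $\nabla$ be a smooth connection in a smooth real vector bundle $W\to M$ of finite rank, with curvature $F^\nabla(X,Y)=[\nabla_X,\nabla_Y]-\nabla_{[X,Y]}$, a 2-form with values in $\mathrm{End}\,W$. Suppose that $\nabla$ is $(\Omega,\lambda)$-self-dual, i.e. $$B_\Omega F^\nabla=\lambda F^\nabla\qquad\text{and}\qquad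 (d{*}\Omega)\wedge F^\nabla=0 .$$ Then $\nabla$ is a Yang–Mills connection: $d^\nabla {*}F^\nabla=0$, where $d^\nabla$ is the covariant exterior derivative on $\mathrm{End}\,W$-valued forms. -/

import Mathlib

open Bundle FiberBundle VectorField
open scoped Manifold ContDiff Topology

set_option linter.unusedSectionVars false

noncomputable section

namespace YMForms

/-! ### Multilinear algebra on a single tangent space -/

section LinearAlgebra

variable {T N : Type*} [AddCommGroup T] [Module ℝ T] [AddCommGroup N] [Module ℝ N]

/-- The wedge product `α ∧ β` of a real `p`-form and an `N`-valued `q`-form: the sum over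
`(p, q)`-shuffles `σ` of `sign σ • α (v ∘ σ ∘ left) • β (v ∘ σ ∘ right)`. -/
def wedge {p q : ℕ} (α : T [⋀^Fin p]→ₗ[ℝ] ℝ) (β : T [⋀^Fin q]→ₗ[ℝ] N) :
    T [⋀^Fin (p + q)]→ₗ[ℝ] N :=
  ((TensorProduct.lid ℝ N).toLinearMap.compAlternatingMap (α.domCoprod β)).domDomCongr
    finSumFinEquiv

open scoped Classical in
/-- The canonical volume form of a nondegenerate symmetric form `g` on an oriented space: in a
basis `b` it is `± √|det (g (b i) (b j))| • b¹ ∧ ⋯ ∧ bⁿ`, with sign `+` iff `b` is positively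
oriented. -/
def volumeForm {n : ℕ} (b : Module.Basis (Fin n) ℝ T) (g : LinearMap.BilinForm ℝ T)
    (o : Orientation ℝ T (Fin n)) : T [⋀^Fin n]→ₗ[ℝ] ℝ :=
  ((if b.orientation = o then (1 : ℝ) else -1) *
    Real.sqrt |(Matrix.of fun i j => g (b i) (b j)).det|) • b.det

theorem append_update_right {S : Type*} {p q : ℕ} (u : Fin p → S) (v : Fin q → S) (i : Fin q)
    (z : S) :
    Fin.append u (Function.update v i z) =
      Function.update (Fin.append u v) (Fin.natAdd p i) z := by
  funext k
  refine Fin.addCases (fun a => ?_) (fun a => ?_) k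
  · have : Fin.castAdd q a ≠ Fin.natAdd p i := by
      intro e
      have := congrArg Fin.val e
      simp at this
      omega
    simp [Function.update_of_ne this]
  · by_cases hai : a = i
    · subst hai
      simp
    · have : Fin.natAdd p a ≠ Fin.natAdd p i := fun e => hai (Fin.natAdd_injective q p e)
      simp [Function.update_of_ne this, Function.update_of_ne hai]

/-- Insertion of the vectors `u` into the first `p` slots of an `n`-form, `n = p + q`. -/
def insertFirst {p q n : ℕ} (h : p + q = n) (η : T [⋀^Fin n]→ₗ[ℝ] ℝ) (u : Fin p → T) :
    T [⋀^Fin q]→ₗ[ℝ] ℝ where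
  toFun v := η (fun k => Fin.append u v (Fin.cast h.symm k))
  map_update_add' := by
    intro inst v i x y
    obtain rfl : inst = instDecidableEqFin q := Subsingleton.elim _ _
    subst h
    simp only [Fin.cast_eq_self, append_update_right]
    exact η.map_update_add _ _ _ _
  map_update_smul' := by
    intro inst v i c x
    obtain rfl : inst = instDecidableEqFin q := Subsingleton.elim _ _
    subst h
    simp only [Fin.cast_eq_self, append_update_right]
    exact η.map_update_smul _ _ _ _
  map_eq_zero_of_eq' := by
    intro v i j hv hij
    subst h
    refine AlternatingMap.map_eq_zero_of_eq η _ (i := Fin.natAdd p i) (j := Fin.natAdd p j) ?_ ?_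
    · simpa using hv
    · exact fun e => hij (Fin.natAdd_injective q p e)

/-- The Hodge star of an `N`-valued `p`-form, with respect to a nondegenerate symmetric form `g`
and an orientation `o`, in a basis `b` (of which it is independent). With `b♯` the `g`-dual basis
and `vol` the volume form,
`(*β)(v) = (1 / p!) ∑_{i₁, …, i_p} vol (b_{i₁}, …, b_{i_p}, v) β (b♯_{i₁}, …, b♯_{i_p})`,
that is `(*β)_{k…} = (1 / p!) β^{i₁…i_p} vol_{i₁…i_p k…}`. For real forms this is the map with
`α ∧ *β = ⟨α, β⟩ vol`; on `η ⊗ C` it is `*η ⊗ C`. -/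
def hodgeStar {p q n : ℕ} (h : p + q = n) (b : Module.Basis (Fin n) ℝ T)
    (g : LinearMap.BilinForm ℝ T) (hg : g.Nondegenerate) (o : Orientation ℝ T (Fin n))
    (β : T [⋀^Fin p]→ₗ[ℝ] N) : T [⋀^Fin q]→ₗ[ℝ] N :=
  ((p.factorial : ℝ)⁻¹) • ∑ i : Fin p → Fin n,
    (LinearMap.toSpanSingleton ℝ N (β fun k => g.dualBasis hg b (i k))).compAlternatingMap
      (insertFirst h (volumeForm b g o) fun k => b (i k))

end LinearAlgebra

/-- An alternating map on a Euclidean space, with its automatic continuity. -/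
def toContinuous {n p : ℕ} (η : EuclideanSpace ℝ (Fin n) [⋀^Fin p]→ₗ[ℝ] ℝ) :
    EuclideanSpace ℝ (Fin n) [⋀^Fin p]→L[ℝ] ℝ where
  toMultilinearMap := η.toMultilinearMap
  cont := by
    let b := (EuclideanSpace.basisFun (Fin n) ℝ).toBasis
    have h : ∀ v : Fin p → EuclideanSpace ℝ (Fin n),
        η v = ∑ r : Fin p → Fin n, (∏ k, (v k) (r k)) • η fun k => b (r k) := by
      intro v
      have hv : v = fun k => ∑ j, (v k) j • b j := by
        funext k
        have := b.sum_repr (v k)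
        simpa [b] using this.symm
      conv_lhs => rw [hv]
      have := MultilinearMap.map_sum η.toMultilinearMap (fun k j => (v k) j • b j)
      simp only [AlternatingMap.coe_multilinearMap] at this
      rw [this]
      refine Finset.sum_congr rfl fun r _ => ?_
      exact MultilinearMap.map_smul_univ η.toMultilinearMap _ _
    have h' : (fun v => η v) = fun v : Fin p → EuclideanSpace ℝ (Fin n) =>
        ∑ r : Fin p → Fin n, (∏ k, (v k) (r k)) • η fun k => b (r k) := funext h
    change Continuous fun v => η v
    rw [h']
    fun_prop
  map_eq_zero_of_eq' := η.map_eq_zero_of_eq'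

/-! ### Pseudo-Riemannian metrics, orientations and differential forms -/

section Manifold

variable (n : ℕ) (M : Type*) [TopologicalSpace M] [ChartedSpace (EuclideanSpace ℝ (Fin n)) M]

/-- A (not necessarily smooth) real `p`-form on the `n`-manifold `M`: a field of alternating
`p`-linear forms on the tangent spaces. -/
abbrev FormField (p : ℕ) : Type _ :=
  Π x : M, TangentSpace (𝓡 n) x [⋀^Fin p]→ₗ[ℝ] ℝ

/-- A field of alternating `p`-linear maps on the tangent spaces of `M` with values in `End V`. -/
abbrev EndFormField (V : M → Type*) [∀ x, AddCommGroup (V x)] [∀ x, Module ℝ (V x)]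
    (p : ℕ) : Type _ :=
  Π x : M, TangentSpace (𝓡 n) x [⋀^Fin p]→ₗ[ℝ] Module.End ℝ (V x)

/-- The standard basis of `T_x M`, which in Mathlib is the model space `ℝⁿ` itself. -/
def tangentBasis {n : ℕ} {M : Type*} [TopologicalSpace M]
    [ChartedSpace (EuclideanSpace ℝ (Fin n)) M] (x : M) :
    Module.Basis (Fin n) ℝ (TangentSpace (𝓡 n) x) :=
  (EuclideanSpace.basisFun (Fin n) ℝ).toBasis

variable [IsManifold (𝓡 n) ∞ M]

variable {n M} in
/-- The vector field `X` is smooth at `x`. -/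
def SmoothFieldAt (X : Π y : M, TangentSpace (𝓡 n) y) (x : M) : Prop :=
  ContMDiffAt (𝓡 n) ((𝓡 n).prod 𝓘(ℝ, EuclideanSpace ℝ (Fin n))) ∞
    (fun y => (⟨y, X y⟩ : TotalSpace (EuclideanSpace ℝ (Fin n)) (TangentSpace (𝓡 n) (M := M)))) x

/-- A smooth pseudo-Riemannian metric of arbitrary signature. -/
structure PseudoRiemannianMetric where
  inner : ∀ x : M, LinearMap.BilinForm ℝ (TangentSpace (𝓡 n) x)
  symm : ∀ x, (inner x).IsSymm
  nondegenerate : ∀ x, (inner x).Nondegenerate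
  /-- `g (X, Y)` is smooth wherever `X` and `Y` are. -/
  smooth : ∀ (x : M) (X Y : Π y : M, TangentSpace (𝓡 n) y),
    SmoothFieldAt X x → SmoothFieldAt Y x →
      ContMDiffAt (𝓡 n) 𝓘(ℝ) ∞ (fun y => inner y (X y) (Y y)) x

/-- An orientation of the manifold `M`: an orientation of every tangent space such that near
every point there is a positively oriented smooth local frame. -/
structure ManifoldOrientation where
  orient : ∀ x : M, Orientation ℝ (TangentSpace (𝓡 n) x) (Fin n)
  locally_frame : ∀ x₀ : M, ∃ u ∈ 𝓝 x₀, ∃ s : Fin n → Π x : M, TangentSpace (𝓡 n) x,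
    ∃ hs : IsLocalFrameOn (𝓡 n) (EuclideanSpace ℝ (Fin n)) ∞ s u,
      ∀ (x : M) (hx : x ∈ u), (hs.toBasisAt hx).orientation = orient x

variable {n M}

/-- `Ω` is a smooth `p`-form: `Ω (X₁, …, X_p)` is smooth wherever the vector fields `X_i` are. -/
def IsSmoothForm {p : ℕ} (Ω : FormField n M p) : Prop :=
  ∀ (x : M) (X : Fin p → Π y : M, TangentSpace (𝓡 n) y),
    (∀ i, SmoothFieldAt (X i) x) → ContMDiffAt (𝓡 n) 𝓘(ℝ) ∞ (fun y => Ω y fun i => X i y) x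

/-- The pull-back of a `p`-form to the model space by the inverse of the chart at `x₀`. -/
def pullbackChart {p : ℕ} (η : FormField n M p) (x₀ : M) (y : EuclideanSpace ℝ (Fin n)) :
    EuclideanSpace ℝ (Fin n) [⋀^Fin p]→ₗ[ℝ] ℝ :=
  (η ((extChartAt (𝓡 n) x₀).symm y)).compLinearMap
    (mfderiv 𝓘(ℝ, EuclideanSpace ℝ (Fin n)) (𝓡 n) (extChartAt (𝓡 n) x₀).symm y).toLinearMap

/-- The exterior derivative of a `p`-form: at `x`, it is computed in the chart `φ` at `x`, as
`φ^* d (φ⁻¹)^* η`. -/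
def extDerivForm {p : ℕ} (η : FormField n M p) : FormField n M (p + 1) := fun x =>
  (extDeriv (fun y => toContinuous (pullbackChart η x y))
      (extChartAt (𝓡 n) x x)).toAlternatingMap.compLinearMap
    (mfderiv (𝓡 n) 𝓘(ℝ, EuclideanSpace ℝ (Fin n)) (extChartAt (𝓡 n) x) x).toLinearMap

/-- The Hodge star of `(M, g)` with orientation `o` at the point `x`, for `p`-forms with values
in any vector space `N`. -/
def hodge (g : PseudoRiemannianMetric n M) (o : ManifoldOrientation n M) {p q : ℕ}
    (h : p + q = n) (x : M) {N : Type*} [AddCommGroup N] [Module ℝ N]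
    (β : TangentSpace (𝓡 n) x [⋀^Fin p]→ₗ[ℝ] N) : TangentSpace (𝓡 n) x [⋀^Fin q]→ₗ[ℝ] N :=
  hodgeStar h (tangentBasis x) (g.inner x) (g.nondegenerate x) (o.orient x) β

end Manifold

/-! ### Connections, curvature and the covariant exterior derivative -/

section Connection

variable {n : ℕ} {M : Type*} [TopologicalSpace M]
  [ChartedSpace (EuclideanSpace ℝ (Fin n)) M] [IsManifold (𝓡 n) ∞ M]
  {F : Type*} [NormedAddCommGroup F] [NormedSpace ℝ F]
  {V : M → Type*} [TopologicalSpace (TotalSpace F V)]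
  [∀ x, AddCommGroup (V x)] [∀ x, Module ℝ (V x)] [∀ x, TopologicalSpace (V x)]
  [∀ x, IsTopologicalAddGroup (V x)] [∀ x, ContinuousSMul ℝ (V x)]
  [FiberBundle F V] [VectorBundle ℝ F V] [ContMDiffVectorBundle ∞ F V (𝓡 n)]

variable (F) in
/-- The extension of `w ∈ V x` to a section of `V`, smooth near `x`, that is constant in the
preferred local trivialization at `x`. For the tangent bundle these are the vector fields with
constant coefficients in the chart at `x`; any two of them commute near `x`. -/
def constExt {x : M} (w : V x) (y : M) : V y :=
  (trivializationAt F V x).symmₗ ℝ y ((trivializationAt F V x).linearMapAt ℝ x w)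

theorem constExt_add {x : M} (w w' : V x) :
    constExt F (w + w') = constExt F w + constExt F w' := by
  funext y
  simp [constExt]

theorem constExt_smul {x : M} (c : ℝ) (w : V x) : constExt F (c • w) = c • constExt F w := by
  funext y
  simp [constExt]

theorem constExt_self {x : M} (w : V x) : constExt F w x = w := by
  have hx := mem_baseSet_trivializationAt' (F := F) (E := V) x
  simp [constExt, hx, Trivialization.coe_linearMapAt_of_mem]

theorem contMDiffOn_constExt {x : M} (w : V x) :
    ContMDiffOn (𝓡 n) ((𝓡 n).prod 𝓘(ℝ, F)) ∞
      (fun y => (⟨y, constExt F w y⟩ : TotalSpace F V)) (trivializationAt F V x).baseSet := by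
  have hx := mem_baseSet_trivializationAt' (F := F) (E := V) x
  intro y hy
  rw [(trivializationAt F V x).contMDiffWithinAt_section _ hy]
  refine (contMDiffWithinAt_const (c := (trivializationAt F V x).linearMapAt ℝ x w)).congr
    (fun z hz => ?_) ?_
  · simp [constExt, hz]
  · simp [constExt, hy]

theorem baseSet_mem_nhds (x : M) : (trivializationAt F V x).baseSet ∈ 𝓝 x :=
  (trivializationAt F V x).open_baseSet.mem_nhds (mem_baseSet_trivializationAt' x)

theorem eventually_mdifferentiableAt_constExt {x : M} (w : V x) :
    ∀ᶠ y in 𝓝 x, MDifferentiableAt (𝓡 n) ((𝓡 n).prod 𝓘(ℝ, F))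
      (fun y => (⟨y, constExt F w y⟩ : TotalSpace F V)) y := by
  filter_upwards [baseSet_mem_nhds (F := F) (V := V) x] with y hy
  exact ((contMDiffOn_constExt w).contMDiffAt
    ((trivializationAt F V x).open_baseSet.mem_nhds hy)).mdifferentiableAt (by simp)

theorem mdifferentiableAt_constExt {x : M} (w : V x) :
    MDifferentiableAt (𝓡 n) ((𝓡 n).prod 𝓘(ℝ, F))
      (fun y => (⟨y, constExt F w y⟩ : TotalSpace F V)) x :=
  (eventually_mdifferentiableAt_constExt w).self_of_nhds

/-- `∇_X σ` is differentiable at `x` if `σ` is smooth near `x` and `X` is differentiable at `x`. -/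
theorem mdifferentiableAt_cov [T2Space M] (cov : CovariantDerivative (𝓡 n) F V)
    (hcov : CovariantDerivative.ContMDiffCovariantDerivative cov ∞) {x : M}
    {X : Π y : M, TangentSpace (𝓡 n) y} {σ : Π y : M, V y}
    (hX : MDifferentiableAt (𝓡 n) ((𝓡 n).prod 𝓘(ℝ, EuclideanSpace ℝ (Fin n)))
      (fun y => (⟨y, X y⟩ : TotalSpace (EuclideanSpace ℝ (Fin n))
        (TangentSpace (𝓡 n) (M := M)))) x)
    {s : Set M} (hs : s ∈ 𝓝 x) (hσ : ContMDiffOn (𝓡 n) ((𝓡 n).prod 𝓘(ℝ, F)) ∞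
      (fun y => (⟨y, σ y⟩ : TotalSpace F V)) s) :
    MDifferentiableAt (𝓡 n) ((𝓡 n).prod 𝓘(ℝ, F))
      (fun y => (⟨y, cov σ y (X y)⟩ : TotalSpace F V)) x := by
  have : ContMDiffVectorBundle 1 F V (𝓡 n) := ContMDiffVectorBundle.of_le (n := ∞) (by simp)
  obtain ⟨u, hus, huo, hxu⟩ := mem_nhds_iff.1 hs
  obtain ⟨f, hf, -⟩ := (SmoothBumpFunction.nhds_basis_support (I := 𝓡 n)
    (huo.mem_nhds hxu)).mem_iff.1 (huo.mem_nhds hxu)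
  have h1 := ContMDiffOn.smul_section_of_tsupport (u := u) (f.contMDiff.contMDiffOn) huo hf
    (hσ.mono hus)
  have h2 := hcov.contMDiff.contMDiff (h1.contMDiffOn)
  have h3 := ((h2.contMDiffAt Filter.univ_mem).mdifferentiableAt (x := x) (by simp)).clm_bundle_apply hX
  refine h3.congr_of_eventuallyEq ?_
  filter_upwards [f.eventuallyEq_one.eventuallyEq_nhds, huo.mem_nhds hxu] with y hy hyu
  have hσy := ((hσ.mono hus).contMDiffAt (huo.mem_nhds hyu)).mdifferentiableAt (by simp)
  have := cov.isCovariantDerivativeOnUniv.congr_of_eventuallyEq (σ := σ) (σ' := ⇑f • σ)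
    hσy ((h1 y).mdifferentiableAt (by simp)) Filter.univ_mem ?_
  · rw [this]
  · filter_upwards [hy] with z hz
    simp [hz]

/-- `∇_X ∇_Y σ - ∇_Y ∇_X σ - ∇_[X,Y] σ` at the point `x`. -/
def curvatureFun (cov : CovariantDerivative (𝓡 n) F V) (X Y : Π y : M, TangentSpace (𝓡 n) y)
    (σ : Π y : M, V y) (x : M) : V x :=
  cov (fun y => cov σ y (Y y)) x (X x) - cov (fun y => cov σ y (X y)) x (Y x)
    - cov σ x (mlieBracket (𝓡 n) X Y x)

/-- `curvatureFun` on the extensions of `v`, `v'` and `w` that are constant in the local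
trivializations at `x`. -/
def curvatureAt (cov : CovariantDerivative (𝓡 n) F V) (x : M) (v v' : TangentSpace (𝓡 n) x)
    (w : V x) : V x :=
  curvatureFun cov (constExt (EuclideanSpace ℝ (Fin n)) v) (constExt (EuclideanSpace ℝ (Fin n)) v')
    (constExt F w) x

theorem curvatureAt_swap (cov : CovariantDerivative (𝓡 n) F V) (x : M)
    (v v' : TangentSpace (𝓡 n) x) (w : V x) :
    curvatureAt cov x v v' w = - curvatureAt cov x v' v w := by
  simp only [curvatureAt, curvatureFun]
  rw [mlieBracket_swap_apply, map_neg]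
  abel

variable [T2Space M] (cov : CovariantDerivative (𝓡 n) F V)

theorem mdifferentiableAt_cov_constExt
    (hcov : CovariantDerivative.ContMDiffCovariantDerivative cov ∞) (x : M)
    (v : TangentSpace (𝓡 n) x) (w : V x) :
    MDifferentiableAt (𝓡 n) ((𝓡 n).prod 𝓘(ℝ, F))
      (fun y => (⟨y, cov (constExt F w) y (constExt (EuclideanSpace ℝ (Fin n)) v y)⟩ :
        TotalSpace F V)) x := by
  exact mdifferentiableAt_cov cov hcov (mdifferentiableAt_constExt v) (baseSet_mem_nhds x)
    (contMDiffOn_constExt w)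

theorem curvatureAt_add_left
    (hcov : CovariantDerivative.ContMDiffCovariantDerivative cov ∞) (x : M)
    (v₁ v₂ v' : TangentSpace (𝓡 n) x) (w : V x) :
    curvatureAt cov x (v₁ + v₂) v' w = curvatureAt cov x v₁ v' w + curvatureAt cov x v₂ v' w := by
  have h1 := mdifferentiableAt_cov_constExt cov hcov x v₁ w
  have h2 := mdifferentiableAt_cov_constExt cov hcov x v₂ w
  have h := cov.isCovariantDerivativeOnUniv.add h1 h2
  simp only [curvatureAt, curvatureFun, constExt_add]
  rw [mlieBracket_add_left (mdifferentiableAt_constExt v₁) (mdifferentiableAt_constExt v₂)]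
  simp only [Pi.add_apply, map_add]
  have e : (fun y => cov (constExt F w) y (constExt (EuclideanSpace ℝ (Fin n)) v₁ y) +
      cov (constExt F w) y (constExt (EuclideanSpace ℝ (Fin n)) v₂ y)) =
    (fun y => cov (constExt F w) y (constExt (EuclideanSpace ℝ (Fin n)) v₁ y)) +
      (fun y => cov (constExt F w) y (constExt (EuclideanSpace ℝ (Fin n)) v₂ y)) := rfl
  rw [e, h]
  simp only [_root_.add_apply]
  abel

theorem curvatureAt_smul_left
    (hcov : CovariantDerivative.ContMDiffCovariantDerivative cov ∞) (x : M)
    (c : ℝ) (v v' : TangentSpace (𝓡 n) x) (w : V x) :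
    curvatureAt cov x (c • v) v' w = c • curvatureAt cov x v v' w := by
  have h1 := mdifferentiableAt_cov_constExt cov hcov x v w
  have h := cov.isCovariantDerivativeOnUniv.smul_const c h1
  simp only [curvatureAt, curvatureFun, constExt_smul]
  rw [mlieBracket_const_smul_left (mdifferentiableAt_constExt v)]
  simp only [Pi.smul_apply, map_smul]
  have e : (fun y => c • cov (constExt F w) y (constExt (EuclideanSpace ℝ (Fin n)) v y)) =
    c • (fun y => cov (constExt F w) y (constExt (EuclideanSpace ℝ (Fin n)) v y)) := rfl
  rw [e, h]
  simp only [_root_.smul_apply, smul_sub]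

theorem curvatureAt_add_right (hcov : CovariantDerivative.ContMDiffCovariantDerivative cov ∞)
    (x : M) (v v₁ v₂ : TangentSpace (𝓡 n) x) (w : V x) :
    curvatureAt cov x v (v₁ + v₂) w = curvatureAt cov x v v₁ w + curvatureAt cov x v v₂ w := by
  rw [curvatureAt_swap, curvatureAt_add_left cov hcov, curvatureAt_swap cov x v₁,
    curvatureAt_swap cov x v₂]
  abel

theorem curvatureAt_smul_right (hcov : CovariantDerivative.ContMDiffCovariantDerivative cov ∞)
    (x : M) (c : ℝ) (v v' : TangentSpace (𝓡 n) x) (w : V x) :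
    curvatureAt cov x v (c • v') w = c • curvatureAt cov x v v' w := by
  rw [curvatureAt_swap, curvatureAt_smul_left cov hcov, curvatureAt_swap cov x v', smul_neg,
    neg_neg]

theorem cov_cov_add
    (hcov : CovariantDerivative.ContMDiffCovariantDerivative cov ∞) (x : M)
    (v v' : TangentSpace (𝓡 n) x) (w w' : V x) :
    cov (fun y => cov (constExt F (w + w')) y (constExt (EuclideanSpace ℝ (Fin n)) v y)) x v' =
      cov (fun y => cov (constExt F w) y (constExt (EuclideanSpace ℝ (Fin n)) v y)) x v' +
      cov (fun y => cov (constExt F w') y (constExt (EuclideanSpace ℝ (Fin n)) v y)) x v' := by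
  have h1 := mdifferentiableAt_cov_constExt cov hcov x v w
  have h2 := mdifferentiableAt_cov_constExt cov hcov x v w'
  have h3 := mdifferentiableAt_cov_constExt cov hcov x v (w + w')
  rw [← _root_.add_apply, ← cov.isCovariantDerivativeOnUniv.add h1 h2]
  have : ContMDiffVectorBundle 1 F V (𝓡 n) := ContMDiffVectorBundle.of_le (n := ∞) (by simp)
  congr 1
  refine cov.isCovariantDerivativeOnUniv.congr_of_eventuallyEq h3
    (mdifferentiableAt_add_section h1 h2) Filter.univ_mem ?_
  filter_upwards [eventually_mdifferentiableAt_constExt (n := n) (F := F) w,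
     eventually_mdifferentiableAt_constExt (n := n) (F := F) w'] with y hy hy'
  have := cov.isCovariantDerivativeOnUniv.add hy
    hy'
  rw [constExt_add, this]
  rfl

theorem cov_cov_smul
    (hcov : CovariantDerivative.ContMDiffCovariantDerivative cov ∞) (x : M)
    (c : ℝ) (v v' : TangentSpace (𝓡 n) x) (w : V x) :
    cov (fun y => cov (constExt F (c • w)) y (constExt (EuclideanSpace ℝ (Fin n)) v y)) x v' =
      c • cov (fun y => cov (constExt F w) y (constExt (EuclideanSpace ℝ (Fin n)) v y)) x v' := by
  have h1 := mdifferentiableAt_cov_constExt cov hcov x v w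
  have h3 := mdifferentiableAt_cov_constExt cov hcov x v (c • w)
  rw [← _root_.smul_apply, ← cov.isCovariantDerivativeOnUniv.smul_const c h1]
  have : ContMDiffVectorBundle 1 F V (𝓡 n) := ContMDiffVectorBundle.of_le (n := ∞) (by simp)
  congr 1
  refine cov.isCovariantDerivativeOnUniv.congr_of_eventuallyEq h3
    (MDifferentiableAt.smul_const_section h1) Filter.univ_mem ?_
  filter_upwards [eventually_mdifferentiableAt_constExt (n := n) (F := F) w] with y hy
  have := cov.isCovariantDerivativeOnUniv.smul_const c hy
  rw [constExt_smul, this]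
  rfl

/-- The curvature `F(X, Y) = [∇_X, ∇_Y] - ∇_[X,Y]` of a smooth connection, as a 2-form with values
in `End V`. -/
def curvature (hcov : CovariantDerivative.ContMDiffCovariantDerivative cov ∞) :
    EndFormField n M V 2 := fun x =>
  { toFun := fun v =>
      { toFun := fun w => curvatureAt cov x (v 0) (v 1) w
        map_add' := by
          intro w w'
          simp only [curvatureAt, curvatureFun, cov_cov_add cov hcov]
          rw [constExt_add, cov.isCovariantDerivativeOnUniv.add (mdifferentiableAt_constExt w)
            (mdifferentiableAt_constExt w')]
          simp only [_root_.add_apply]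
          abel
        map_smul' := by
          intro c w
          simp only [curvatureAt, curvatureFun, cov_cov_smul cov hcov]
          rw [constExt_smul, cov.isCovariantDerivativeOnUniv.smul_const c
            (mdifferentiableAt_constExt w)]
          simp only [_root_.smul_apply, smul_sub, RingHom.id_apply] }
    map_update_add' := by
      intro inst v i a b
      obtain rfl : inst = instDecidableEqFin 2 := Subsingleton.elim _ _
      ext w
      fin_cases i
      · simpa using curvatureAt_add_left cov hcov x a b (v 1) w
      · simpa using curvatureAt_add_right cov hcov x (v 0) a b w
    map_update_smul' := by
      intro inst v i c a
      obtain rfl : inst = instDecidableEqFin 2 := Subsingleton.elim _ _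
      ext w
      fin_cases i
      · simpa using curvatureAt_smul_left cov hcov x c a (v 1) w
      · simpa using curvatureAt_smul_right cov hcov x c (v 0) a w
    map_eq_zero_of_eq' := by
      intro v i j hv hij
      have h01 : v 0 = v 1 := by
        fin_cases i <;> fin_cases j <;> simp_all
      ext w
      simp [curvatureAt, curvatureFun, ← h01] }

/-- The connection induced by `∇` on `End V`: `(∇_v C) w = ∇_v (C σ) - C (∇_v σ)` at `x`, where
`σ` is a section with `σ x = w`. -/
def covEnd (C : Π y : M, Module.End ℝ (V y)) (x : M) (v : TangentSpace (𝓡 n) x) (w : V x) : V x :=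
  cov (fun y => C y (constExt F w y)) x v - C x (cov (constExt F w) x v)

/-- The covariant exterior derivative of an `End V`-valued `p`-form: for commuting vector fields
`X_i`, `(d^∇ α)(X_0, …, X_p) = ∑ i, (-1)^i ∇_{X_i} (α (X_0, …, X̂_i, …, X_p))`, here evaluated at
`x` on the fields `X_i` with value `v i` at `x` that are constant in the chart at `x`. -/
def covExtDeriv {p : ℕ} (α : EndFormField n M V p) (x : M) (v : Fin (p + 1) → TangentSpace (𝓡 n) x)
    (w : V x) : V x :=
  ∑ i : Fin (p + 1), (-1 : ℝ) ^ (i : ℕ) •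
    covEnd cov (fun y => α y fun j => constExt (EuclideanSpace ℝ (Fin n)) (v (i.succAbove j)) y)
      x (v i) w

end Connection

/-! ### Self-duality and the Yang-Mills equation -/

section YangMills

variable {m : ℕ} {M : Type*} [TopologicalSpace M]
  [ChartedSpace (EuclideanSpace ℝ (Fin (m + 4))) M] [IsManifold (𝓡 (m + 4)) ∞ M]
  (g : PseudoRiemannianMetric (m + 4) M) (o : ManifoldOrientation (m + 4) M)

/-- The `m`-form `*Ω` of a 4-form `Ω` on an `(m + 4)`-manifold. -/
def starFour (Ω : FormField (m + 4) M 4) : FormField (m + 4) M m :=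
  fun x => hodge g o (Nat.add_comm 4 m) x (Ω x)

/-- `B_Ω β = *(*Ω ∧ β)`, for a 2-form `β` at `x` with values in any vector space. -/
def opB (Ω : FormField (m + 4) M 4) (x : M) {N : Type*} [AddCommGroup N] [Module ℝ N]
    (β : TangentSpace (𝓡 (m + 4)) x [⋀^Fin 2]→ₗ[ℝ] N) :
    TangentSpace (𝓡 (m + 4)) x [⋀^Fin 2]→ₗ[ℝ] N :=
  hodge g o (p := m + 2) (q := 2) rfl x (wedge (starFour g o Ω x) β)

/-- `B_Ω` has a nonzero real constant eigenvalue. -/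
def IsAppropriate (Ω : FormField (m + 4) M 4) : Prop :=
  ∃ μ : ℝ, μ ≠ 0 ∧ ∀ x : M, ∃ β : TangentSpace (𝓡 (m + 4)) x [⋀^Fin 2]→ₗ[ℝ] ℝ,
    β ≠ 0 ∧ opB g o Ω x β = μ • β

variable {F : Type*} [NormedAddCommGroup F] [NormedSpace ℝ F]
  {V : M → Type*} [TopologicalSpace (TotalSpace F V)]
  [∀ x, AddCommGroup (V x)] [∀ x, Module ℝ (V x)] [∀ x, TopologicalSpace (V x)]
  [∀ x, IsTopologicalAddGroup (V x)] [∀ x, ContinuousSMul ℝ (V x)]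
  [FiberBundle F V] [VectorBundle ℝ F V] [ContMDiffVectorBundle ∞ F V (𝓡 (m + 4))] [T2Space M]

/-- `(Ω, μ)`-self-duality of a smooth connection with curvature `F`: `B_Ω F = μ F` and
`(d *Ω) ∧ F = 0`. -/
def IsSelfDual (Ω : FormField (m + 4) M 4) (μ : ℝ) (cov : CovariantDerivative (𝓡 (m + 4)) F V)
    (hcov : CovariantDerivative.ContMDiffCovariantDerivative cov ∞) : Prop :=
  (∀ x : M, opB g o Ω x (curvature cov hcov x) = μ • curvature cov hcov x) ∧
    ∀ x : M, wedge (extDerivForm (starFour g o Ω) x) (curvature cov hcov x) = 0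

/-- The `End V`-valued form `*F`, where `F` is the curvature of a smooth connection. -/
def starCurvature (cov : CovariantDerivative (𝓡 (m + 4)) F V)
    (hcov : CovariantDerivative.ContMDiffCovariantDerivative cov ∞) :
    EndFormField (m + 4) M V (m + 2) :=
  fun x => hodge g o (p := 2) (by omega) x (curvature cov hcov x)

/-- The Yang-Mills equation `d^∇ *F = 0`. -/
def IsYangMills (cov : CovariantDerivative (𝓡 (m + 4)) F V)
    (hcov : CovariantDerivative.ContMDiffCovariantDerivative cov ∞) : Prop :=
  ∀ (x : M) (v : Fin (m + 2 + 1) → TangentSpace (𝓡 (m + 4)) x) (w : V x),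
    covExtDeriv cov (starCurvature g o cov hcov) x v w = 0

end YangMills

end YMForms

end

/-!
A self-dual connection is Yang-Mills because its curvature satisfies the Bianchi identity. Applying
the Hodge star to `*(*Ω ∧ F) = μ F` and using `** = ±1` (`hodgeStar_hodgeStar`) gives
`*F = c (*Ω ∧ F)` with `c = ± μ⁻¹`; the sign depends on the degrees and on the signature of the
metric only, hence `c` is locally constant (`eventually_starCurvature_eq`). Therefore
`d^∇ *F = c ((d *Ω) ∧ F ± *Ω ∧ d^∇ F)`, where the first term vanishes by the second self-duality
equation and the second one by the Bianchi identity.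

All derivatives are computed at a fixed point `x`, in components with respect to the coordinate
fields of the chart at `x`, which commute. The derivative of the components of a `p`-form is a
linear map from `T_x M` to the alternating `p`-forms, and exterior differentiation is its
alternatization `AlternatingMap.alternatizeUncurryFin`: for `*Ω` this yields `d *Ω`
(`alternatizeUncurryFin_formDeriv`, which rests on `extDerivForm_apply`), and for the curvature it
yields `0`, which is the Bianchi identity (`alternatizeUncurryFin_curvatureDeriv`). The Leibniz rule
for `d^∇` splits into the pointwise product rule `covEnd_starCurvature` and the purely algebraic
compatibility of the alternatization with wedge products (`alternatizeUncurryFin_wedge_left`,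
`alternatizeUncurryFin_wedge_right`).

Two points need care. The form `*Ω` has to be differentiable, although the Hodge star is defined
with a basis of each tangent space that does not vary continuously: the star does not depend on the
basis (`hodgeStar_eq`), and in the coordinate frame all its ingredients are smooth
(`IsSmoothForm.hodge`). The curvature is defined at each point `y` by fields that are constant in
the chart and the trivialization at `y`, so its derivative at `x` can only be computed after it has
been identified, for all `y` near `x`, with the commutator of covariant derivatives along fields
that do not depend on `y` (`curvature_coordField`); this is the tensoriality of the curvature in
all three arguments.
-/


namespace YMForms

/-! ### Wedge products and alternatization -/

section WedgeAlgebra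

variable {T N : Type*} [AddCommGroup T] [Module ℝ T] [AddCommGroup N] [Module ℝ N]

theorem alternatization_domDomCongr {ι ι' : Type*} [Fintype ι] [DecidableEq ι] [Fintype ι']
    [DecidableEq ι'] (e : ι ≃ ι') (m : MultilinearMap ℝ (fun _ : ι => T) N) :
    MultilinearMap.alternatization (m.domDomCongr e) =
      (MultilinearMap.alternatization m).domDomCongr e := by
  ext v
  simp only [MultilinearMap.alternatization_apply, AlternatingMap.domDomCongr_apply,
    MultilinearMap.domDomCongr_apply]
  refine Fintype.sum_equiv e.symm.permCongr _ _ fun σ => ?_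
  simp

/-- A permutation of the arguments changes the alternatization by its sign. -/
theorem alternatization_domDomCongr_perm {ι : Type*} [Fintype ι] [DecidableEq ι]
    (σ : Equiv.Perm ι) (m : MultilinearMap ℝ (fun _ : ι => T) N) :
    MultilinearMap.alternatization (m.domDomCongr σ) =
      Equiv.Perm.sign σ • MultilinearMap.alternatization m := by
  rw [alternatization_domDomCongr]
  exact AlternatingMap.domDomCongr_perm _ σ

/-- The product `u ↦ a (u ∘ left) • b (u ∘ right)` of two multilinear maps, before
alternatization. -/
noncomputable def smulProd {p q : ℕ} (a : MultilinearMap ℝ (fun _ : Fin p => T) ℝ)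
    (b : MultilinearMap ℝ (fun _ : Fin q => T) N) :
    MultilinearMap ℝ (fun _ : Fin (p + q) => T) N :=
  ((TensorProduct.lid ℝ N).toLinearMap.compMultilinearMap (a.domCoprod b)).domDomCongr
    finSumFinEquiv

@[simp]
theorem smulProd_apply {p q : ℕ} (a : MultilinearMap ℝ (fun _ : Fin p => T) ℝ)
    (b : MultilinearMap ℝ (fun _ : Fin q => T) N) (u : Fin (p + q) → T) :
    smulProd a b u = a (fun i => u (Fin.castAdd q i)) • b (fun j => u (Fin.natAdd p j)) := by
  simp [smulProd]

theorem alternatization_smulProd {p q : ℕ} (a : MultilinearMap ℝ (fun _ : Fin p => T) ℝ)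
    (b : MultilinearMap ℝ (fun _ : Fin q => T) N) :
    MultilinearMap.alternatization (smulProd a b) =
      wedge (MultilinearMap.alternatization a) (MultilinearMap.alternatization b) := by
  rw [smulProd, alternatization_domDomCongr, LinearMap.compMultilinearMap_alternatization,
    MultilinearMap.domCoprod_alternization, wedge]

theorem wedge_smul_left {p q : ℕ} (c : ℝ) (α : T [⋀^Fin p]→ₗ[ℝ] ℝ) (β : T [⋀^Fin q]→ₗ[ℝ] N) :
    wedge (c • α) β = c • wedge α β := by
  have h : (c • α).domCoprod β = c • α.domCoprod β := by
    rw [← AlternatingMap.domCoprod'_apply, ← AlternatingMap.domCoprod'_apply,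
      ← TensorProduct.smul_tmul', map_smul]
  ext v
  simp [wedge, h]

theorem wedge_smul_right {p q : ℕ} (c : ℝ) (α : T [⋀^Fin p]→ₗ[ℝ] ℝ) (β : T [⋀^Fin q]→ₗ[ℝ] N) :
    wedge α (c • β) = c • wedge α β := by
  have h : α.domCoprod (c • β) = c • α.domCoprod β := by
    rw [← AlternatingMap.domCoprod'_apply, ← AlternatingMap.domCoprod'_apply,
      TensorProduct.tmul_smul, map_smul]
  ext v
  simp [wedge, h]

theorem wedge_add_left {p q : ℕ} (α α' : T [⋀^Fin p]→ₗ[ℝ] ℝ) (β : T [⋀^Fin q]→ₗ[ℝ] N) :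
    wedge (α + α') β = wedge α β + wedge α' β := by
  have h : (α + α').domCoprod β = α.domCoprod β + α'.domCoprod β := by
    simp only [← AlternatingMap.domCoprod'_apply, TensorProduct.add_tmul, map_add]
  ext v
  simp [wedge, h]

theorem wedge_add_right {p q : ℕ} (α : T [⋀^Fin p]→ₗ[ℝ] ℝ) (β β' : T [⋀^Fin q]→ₗ[ℝ] N) :
    wedge α (β + β') = wedge α β + wedge α β' := by
  have h : α.domCoprod (β + β') = α.domCoprod β + α.domCoprod β' := by
    simp only [← AlternatingMap.domCoprod'_apply, TensorProduct.tmul_add, map_add]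
  ext v
  simp [wedge, h]

theorem wedge_zero_right {p q : ℕ} (α : T [⋀^Fin p]→ₗ[ℝ] ℝ) :
    wedge α (0 : T [⋀^Fin q]→ₗ[ℝ] N) = 0 := by
  simpa using wedge_smul_right 0 α (0 : T [⋀^Fin q]→ₗ[ℝ] N)

/-- Summing over all permutations counts every shuffle `p! q!` times. -/
theorem factorial_smul_wedge {p q : ℕ} (α : T [⋀^Fin p]→ₗ[ℝ] ℝ) (β : T [⋀^Fin q]→ₗ[ℝ] N) :
    ((p.factorial : ℝ) * q.factorial) • wedge α β =
      MultilinearMap.alternatization (smulProd α.toMultilinearMap β.toMultilinearMap) := by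
  have hα := AlternatingMap.coe_alternatization α
  have hβ := AlternatingMap.coe_alternatization β
  rw [alternatization_smulProd, hα, hβ, Fintype.card_fin, Fintype.card_fin, mul_smul,
    ← Nat.cast_smul_eq_nsmul ℝ, ← Nat.cast_smul_eq_nsmul ℝ, wedge_smul_left, wedge_smul_right]

/-- The wedge product as a sum over all permutations, which unlike the sum over shuffles makes every
term explicit. -/
theorem wedge_apply {p q : ℕ} (α : T [⋀^Fin p]→ₗ[ℝ] ℝ) (β : T [⋀^Fin q]→ₗ[ℝ] N)
    (v : Fin (p + q) → T) :
    wedge α β v = ∑ σ : Equiv.Perm (Fin (p + q)),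
      (((p.factorial : ℝ) * q.factorial)⁻¹ * ((Equiv.Perm.sign σ : ℤ) : ℝ)) •
        (α fun i => v (σ (Fin.castAdd q i))) • β fun j => v (σ (Fin.natAdd p j)) := by
  have h : ((p.factorial : ℝ) * q.factorial) ≠ 0 := by positivity
  have := congrArg (fun f => ((p.factorial : ℝ) * q.factorial)⁻¹ • f v) (factorial_smul_wedge α β)
  simp only [AlternatingMap.smul_apply, smul_smul, inv_mul_cancel₀ h, one_smul,
    MultilinearMap.alternatization_apply, MultilinearMap.domDomCongr_apply, smulProd_apply] at this
  rw [this, Finset.smul_sum]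
  refine Finset.sum_congr rfl fun σ _ => ?_
  rw [mul_smul, Units.smul_def, ← Int.cast_smul_eq_zsmul ℝ]
  rfl

theorem wedge_compAlternatingMap {N' : Type*} [AddCommGroup N'] [Module ℝ N'] {p q : ℕ}
    (f : N →ₗ[ℝ] N') (α : T [⋀^Fin p]→ₗ[ℝ] ℝ) (β : T [⋀^Fin q]→ₗ[ℝ] N) :
    wedge α (f.compAlternatingMap β) = f.compAlternatingMap (wedge α β) := by
  ext v
  simp [wedge_apply, map_sum]

open AlternatingMap

/-- Left uncurrying of a linear family of multilinear maps. -/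
noncomputable def uncurryL {n : ℕ} (K : T →ₗ[ℝ] MultilinearMap ℝ (fun _ : Fin n => T) N) :
    MultilinearMap ℝ (fun _ : Fin (n + 1) => T) N :=
  LinearMap.uncurryLeft K

@[simp]
theorem uncurryL_apply {n : ℕ} (K : T →ₗ[ℝ] MultilinearMap ℝ (fun _ : Fin n => T) N)
    (u : Fin (n + 1) → T) : uncurryL K u = K (u 0) (fun i => u i.succ) := rfl

/-- Alternatizing a form with one distinguished slot is summing over the position of that slot; the
`n!` permutations of the other slots agree. -/
theorem alternatization_uncurryL {n : ℕ} (A : T →ₗ[ℝ] T [⋀^Fin n]→ₗ[ℝ] N) :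
    MultilinearMap.alternatization (uncurryL (toMultilinearMapLM ∘ₗ A)) =
      (n.factorial : ℝ) • alternatizeUncurryFin A := by
  set M := uncurryL (toMultilinearMapLM (R := ℝ) (S := ℝ) ∘ₗ A) with hM
  have h1 : (alternatizeUncurryFin A).toMultilinearMap =
      ∑ i : Fin (n + 1), (Equiv.Perm.sign i.cycleRange.symm : ℤ) •
        M.domDomCongr i.cycleRange.symm := by
    ext v
    simp only [_root_.sum_apply, _root_.smul_apply, MultilinearMap.domDomCongr_apply]
    refine (alternatizeUncurryFin_apply A v).trans (Finset.sum_congr rfl fun i _ => ?_)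
    have e0 : v (i.cycleRange.symm 0) = v i := by rw [Fin.cycleRange_symm_zero]
    have e1 : (fun j : Fin n => v (i.cycleRange.symm j.succ)) = i.removeNth v := by
      funext j
      rw [Fin.cycleRange_symm_succ, Fin.removeNth]
    simp only [Equiv.Perm.sign_symm, Fin.sign_cycleRange, hM, uncurryL_apply]
    rw [e0, e1]
    simp
  have h2 := AlternatingMap.coe_alternatization (alternatizeUncurryFin A)
  rw [Fintype.card_fin] at h2
  have h3 : MultilinearMap.alternatization (alternatizeUncurryFin A).toMultilinearMap =
      ((n + 1 : ℕ) : ℝ) • MultilinearMap.alternatization M := by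
    rw [h1, map_sum]
    have : ∀ i : Fin (n + 1), MultilinearMap.alternatization
        ((Equiv.Perm.sign i.cycleRange.symm : ℤ) • M.domDomCongr i.cycleRange.symm) =
        MultilinearMap.alternatization M := by
      intro i
      rw [map_zsmul, alternatization_domDomCongr_perm, ← Units.smul_def, smul_smul,
        Int.units_mul_self, one_smul]
    simp only [this, Finset.sum_const, Finset.card_univ, Fintype.card_fin]
    rw [Nat.cast_smul_eq_nsmul]
  have h4 : ((n + 1 : ℕ) : ℝ) ≠ 0 := by positivity
  have h5 := h3.symm.trans h2
  rw [← Nat.cast_smul_eq_nsmul ℝ, Nat.factorial_succ, Nat.cast_mul, mul_smul] at h5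
  exact smul_right_injective _ h4 h5

/-- Alternatization of the last `n` arguments before full alternatization is redundant up to the
factor `n!`. -/
theorem alternatizeUncurryFin_of_alternatization {n : ℕ}
    (A : T →ₗ[ℝ] T [⋀^Fin n]→ₗ[ℝ] N) (K : T →ₗ[ℝ] MultilinearMap ℝ (fun _ : Fin n => T) N)
    (h : ∀ v, A v = MultilinearMap.alternatization (K v)) :
    alternatizeUncurryFin A = MultilinearMap.alternatization (uncurryL K) := by
  have h1 : uncurryL (toMultilinearMapLM (R := ℝ) (S := ℝ) ∘ₗ A) =
      ∑ τ : Equiv.Perm (Fin n), (Equiv.Perm.sign τ : ℤ) •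
        (uncurryL K).domDomCongr (Equiv.Perm.decomposeFin.symm (0, τ)) := by
    refine MultilinearMap.ext fun (v : Fin (n + 1) → T) => ?_
    simp only [_root_.sum_apply, _root_.smul_apply, MultilinearMap.domDomCongr_apply,
      uncurryL_apply]
    change A (v 0) (fun i => v i.succ) = _
    rw [h, MultilinearMap.alternatization_apply]
    refine Finset.sum_congr rfl fun τ _ => ?_
    have e0 : v (Equiv.Perm.decomposeFin.symm (0, τ) 0) = v 0 := by simp
    have e1 : (fun j : Fin n => v (Equiv.Perm.decomposeFin.symm (0, τ) j.succ)) =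
        fun j => v (τ j).succ := by
      funext j
      simp
    rw [e0, e1]
    simp [Units.smul_def]
  have h2 : MultilinearMap.alternatization (uncurryL (toMultilinearMapLM (R := ℝ) (S := ℝ) ∘ₗ A)) =
      (n.factorial : ℝ) • MultilinearMap.alternatization (uncurryL K) := by
    rw [h1, map_sum]
    have : ∀ τ : Equiv.Perm (Fin n), MultilinearMap.alternatization
        ((Equiv.Perm.sign τ : ℤ) • (uncurryL K).domDomCongr
          (Equiv.Perm.decomposeFin.symm (0, τ))) =
        MultilinearMap.alternatization (uncurryL K) := by
      intro τ
      rw [map_zsmul, alternatization_domDomCongr_perm, ← Units.smul_def, smul_smul,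
        Equiv.Perm.decomposeFin.symm_sign]
      simp
    simp only [this, Finset.sum_const, Finset.card_univ, Fintype.card_perm, Fintype.card_fin]
    rw [Nat.cast_smul_eq_nsmul]
  rw [alternatization_uncurryL] at h2
  exact smul_right_injective _ (Nat.cast_ne_zero.2 n.factorial_ne_zero) h2

/-- Exterior differentiation of the left factor of a wedge product, at the level of first-order
jets: `A` is the derivative of the left factor, while the right factor `β` is constant. -/
theorem alternatizeUncurryFin_wedge_left {p q : ℕ} (A : T →ₗ[ℝ] T [⋀^Fin p]→ₗ[ℝ] ℝ)
    (β : T [⋀^Fin q]→ₗ[ℝ] N) (W : T →ₗ[ℝ] T [⋀^Fin (p + q)]→ₗ[ℝ] N)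
    (hW : ∀ v, W v = wedge (A v) β) :
    alternatizeUncurryFin W = (wedge (alternatizeUncurryFin A) β).domDomCongr
      (finCongr (Nat.succ_add p q)) := by
  set c : ℝ := (p.factorial : ℝ) * q.factorial with hc
  have hc0 : c ≠ 0 := by positivity
  let K : T →ₗ[ℝ] MultilinearMap ℝ (fun _ : Fin (p + q) => T) N :=
    { toFun := fun v => smulProd (A v).toMultilinearMap β.toMultilinearMap
      map_add' := fun v w => by
        ext u
        simp [add_smul]
      map_smul' := fun r v => by
        ext u
        simp [mul_smul] }
  have h1 : ∀ v, (c • W) v = MultilinearMap.alternatization (K v) := fun v => by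
    rw [LinearMap.smul_apply, hW, hc, factorial_smul_wedge]
    rfl
  have h2 : uncurryL K = (smulProd (uncurryL (toMultilinearMapLM (R := ℝ) (S := ℝ) ∘ₗ A))
      β.toMultilinearMap).domDomCongr (finCongr (Nat.succ_add p q)) := by
    ext u
    rw [uncurryL_apply, MultilinearMap.domDomCongr_apply, smulProd_apply, uncurryL_apply]
    change smulProd (A (u 0)).toMultilinearMap β.toMultilinearMap (fun i => u i.succ) = _
    rw [smulProd_apply]
    congr 2
    funext j
    exact congrArg u (Fin.ext (by simp; omega))
  have h3 := alternatizeUncurryFin_of_alternatization _ K h1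
  rw [h2, alternatization_domDomCongr, alternatization_smulProd, alternatization_uncurryL,
    AlternatingMap.coe_alternatization, Fintype.card_fin, ← Nat.cast_smul_eq_nsmul ℝ,
    wedge_smul_left, wedge_smul_right, smul_smul, ← hc, alternatizeUncurryFin_smul] at h3
  exact smul_right_injective _ hc0 h3

/-- Exterior differentiation of the right factor of a wedge product. The sign `(-1)^p` is that of
the bijection `e`, which moves the differentiated slot past the `p` slots of `α`. -/
theorem alternatizeUncurryFin_wedge_right {p q : ℕ} (α : T [⋀^Fin p]→ₗ[ℝ] ℝ)
    (B : T →ₗ[ℝ] T [⋀^Fin q]→ₗ[ℝ] N) (W : T →ₗ[ℝ] T [⋀^Fin (p + q)]→ₗ[ℝ] N)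
    (hW : ∀ v, W v = wedge α (B v)) :
    ∃ e : Fin (p + (q + 1)) ≃ Fin (p + q + 1),
      alternatizeUncurryFin W = (wedge α (alternatizeUncurryFin B)).domDomCongr e := by
  set c : ℝ := (p.factorial : ℝ) * q.factorial with hc
  have hc0 : c ≠ 0 := by positivity
  let K : T →ₗ[ℝ] MultilinearMap ℝ (fun _ : Fin (p + q) => T) N :=
    { toFun := fun v => smulProd α.toMultilinearMap (B v).toMultilinearMap
      map_add' := fun v w => by
        ext u
        simp
      map_smul' := fun r v => by
        ext u
        simp [smul_comm r] }
  have h1 : ∀ v, (c • W) v = MultilinearMap.alternatization (K v) := fun v => by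
    rw [LinearMap.smul_apply, hW, hc, factorial_smul_wedge]
    rfl
  let s : Fin (p + (q + 1)) → Fin (p + q + 1) := Fin.addCases
    (fun i => (Fin.castAdd q i).succ) (Fin.cons 0 fun j => (Fin.natAdd p j).succ)
  have hs : Function.Injective s := by
    intro a b
    refine Fin.addCases (fun i => ?_) (fun i => ?_) a <;>
      refine Fin.addCases (fun j => ?_) (fun j => ?_) b
    · simp [s]
    · refine Fin.cases ?_ (fun j => ?_) j
      · simp [s]
      · simp only [s, Fin.addCases_left, Fin.addCases_right, Fin.cons_succ, Fin.ext_iff]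
        simp
        omega
    · refine Fin.cases ?_ (fun i => ?_) i
      · simp [s, Fin.ext_iff]
      · simp only [s, Fin.addCases_left, Fin.addCases_right, Fin.cons_succ, Fin.ext_iff]
        simp
        omega
    · refine Fin.cases ?_ (fun i => ?_) i <;> refine Fin.cases ?_ (fun j => ?_) j
      · simp
      · simp [s, Fin.ext_iff]
      · simp [s, Fin.ext_iff]
      · simp only [s, Fin.addCases_right, Fin.cons_succ, Fin.ext_iff]
        simp
  let e : Fin (p + (q + 1)) ≃ Fin (p + q + 1) :=
    Equiv.ofBijective s ((Fintype.bijective_iff_injective_and_card s).2 ⟨hs, by simp; omega⟩)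
  have h2 : uncurryL K = (smulProd α.toMultilinearMap
      (uncurryL (toMultilinearMapLM (R := ℝ) (S := ℝ) ∘ₗ B))).domDomCongr e := by
    ext u
    rw [uncurryL_apply, MultilinearMap.domDomCongr_apply, smulProd_apply, uncurryL_apply]
    change smulProd α.toMultilinearMap (B (u 0)).toMultilinearMap (fun i => u i.succ) = _
    rw [smulProd_apply]
    have e0 : s (Fin.natAdd p 0) = 0 := by simp [s]
    have e1 : ∀ i, s (Fin.castAdd (q + 1) i) = (Fin.castAdd q i).succ := fun i => by simp [s]
    have e2 : ∀ j : Fin q, s (Fin.natAdd p j.succ) = (Fin.natAdd p j).succ := fun j => by simp [s]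
    change _ = α (fun i => u (s _)) • B (u (s _)) (fun j => u (s _))
    rw [e0, funext fun i => congrArg u (e1 i), funext fun j => congrArg u (e2 j)]
    rfl
  refine ⟨e, ?_⟩
  have h3 := alternatizeUncurryFin_of_alternatization _ K h1
  rw [h2, alternatization_domDomCongr, alternatization_smulProd, alternatization_uncurryL,
    AlternatingMap.coe_alternatization, Fintype.card_fin, ← Nat.cast_smul_eq_nsmul ℝ,
    wedge_smul_left, wedge_smul_right, smul_smul, ← hc, alternatizeUncurryFin_smul] at h3
  exact smul_right_injective _ hc0 h3

end WedgeAlgebra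

/-! ### Determinants and insertion into forms -/

section HodgeAlgebra

open Module

variable {T N : Type*} [AddCommGroup T] [Module ℝ T] [AddCommGroup N] [Module ℝ N]

theorem alternatingMap_sum_apply {ι κ : Type*} (s : Finset κ) (f : κ → T [⋀^ι]→ₗ[ℝ] N)
    (v : ι → T) : (∑ k ∈ s, f k) v = ∑ k ∈ s, f k v := by
  induction s using Finset.cons_induction with
  | empty => simp
  | cons a s ha ih => rw [Finset.sum_cons, Finset.sum_cons, AlternatingMap.add_apply, ih]

/-- The sign of the permutation exchanging a block of `p` slots with a block of `q` slots, that is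
`(-1)^(pq)`. -/
noncomputable def blockSign {p q n : ℕ} (h : p + q = n) (h' : q + p = n) : ℤˣ :=
  Equiv.Perm.sign (((finCongr h).symm.trans finAddFlip).trans (finCongr h'))

theorem map_append_swap {p q n : ℕ} (h : p + q = n) (h' : q + p = n) (η : T [⋀^Fin n]→ₗ[ℝ] N)
    (u : Fin p → T) (v : Fin q → T) :
    η (fun k => Fin.append u v (Fin.cast h.symm k)) =
      blockSign h h' • η (fun k => Fin.append v u (Fin.cast h'.symm k)) := by
  rw [blockSign, ← AlternatingMap.map_perm]
  congr 1
  funext k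
  obtain ⟨k, rfl⟩ := (finCongr h).surjective k
  refine Fin.addCases (fun i => ?_) (fun i => ?_) k <;> simp

/-- If `α` vanishes as soon as one of its arguments is among the last vectors of `u`, then only
one shuffle contributes to `α ∧ β` at `u`. -/
theorem wedge_apply_of_forall_eq_zero {p q : ℕ} (α : T [⋀^Fin q]→ₗ[ℝ] ℝ)
    (β : T [⋀^Fin p]→ₗ[ℝ] N) (u : Fin (q + p) → T)
    (hα : ∀ (v : Fin q → T) (i : Fin q) (j : Fin p), v i = u (Fin.natAdd q j) → α v = 0) :
    wedge α β u = α (fun i => u (Fin.castAdd p i)) • β (fun j => u (Fin.natAdd q j)) := by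
  simp only [wedge, AlternatingMap.domDomCongr_apply, LinearMap.compAlternatingMap_apply,
    AlternatingMap.domCoprod_apply, _root_.sum_apply]
  rw [map_sum]
  refine (Finset.sum_eq_single (Quotient.mk'' 1) ?_ ?_).trans ?_
  · intro σ _ hσ
    induction σ using Quotient.inductionOn' with | _ σ
    rw [AlternatingMap.domCoprod.summand_mk'']
    by_cases hm : Set.MapsTo σ (Set.range Sum.inl) (Set.range Sum.inl)
    · refine absurd ?_ hσ
      refine Quotient.sound' ?_
      rw [QuotientGroup.leftRel_apply, mul_one]
      exact inv_mem (Equiv.Perm.mem_sumCongrHom_range_of_perm_mapsTo_inl hm)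
    · simp only [Set.MapsTo, Set.mem_range, not_forall] at hm
      obtain ⟨_, ⟨i, rfl⟩, hi⟩ := hm
      obtain ⟨j, hj⟩ : ∃ j, σ (Sum.inl i) = Sum.inr j := by
        rcases hs : σ (Sum.inl i) with a | a
        · exact absurd ⟨a, hs.symm⟩ hi
        · exact ⟨a, rfl⟩
      have := hα (fun k => u (finSumFinEquiv (σ (Sum.inl k)))) i j (by rw [hj]; simp)
      simp [MultilinearMap.domCoprod_apply, this]
  · simp
  · simp [AlternatingMap.domCoprod.summand_mk'']

/-- An injective choice of the last `p` values extends to a permutation. -/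
theorem exists_perm_extend {q p : ℕ} (k : Fin p → Fin (q + p)) (hk : Function.Injective k) :
    ∃ τ : Equiv.Perm (Fin (q + p)), ∀ j, τ (Fin.natAdd q j) = k j := by
  classical
  let e : {x // x ∈ Set.range (Fin.natAdd q : Fin p → _)} ≃ {x // x ∈ Set.range k} :=
    (Equiv.ofInjective _ (Fin.natAdd_injective p q)).symm.trans (Equiv.ofInjective k hk)
  refine ⟨e.extendSubtype, fun j => ?_⟩
  rw [e.extendSubtype_apply_of_mem _ ⟨j, rfl⟩]
  have : (⟨Fin.natAdd q j, ⟨j, rfl⟩⟩ : {x // x ∈ Set.range (Fin.natAdd q : Fin p → _)}) =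
      Equiv.ofInjective _ (Fin.natAdd_injective p q) j := rfl
  rw [this]
  simp [e]

/-- The contraction `u ↦ η (u, v)` of an `n`-form with vectors `v` filled into its last `q` slots. -/
noncomputable def insertLast {p q n : ℕ} (h : p + q = n) (h' : q + p = n)
    (η : T [⋀^Fin n]→ₗ[ℝ] ℝ) (v : Fin q → T) : T [⋀^Fin p]→ₗ[ℝ] ℝ :=
  (blockSign h h') • insertFirst h' η v

theorem insertLast_apply {p q n : ℕ} (h : p + q = n) (h' : q + p = n) (η : T [⋀^Fin n]→ₗ[ℝ] ℝ)
    (v : Fin q → T) (u : Fin p → T) :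
    insertLast h h' η v u = η (fun k => Fin.append u v (Fin.cast h.symm k)) := by
  rw [map_append_swap h h', insertLast]
  rfl

/-- `vol (·, w) ∧ β = β(w) vol`, evaluated at the basis `b` with `vol = b.det`. -/
theorem wedge_insertLast_det {p q : ℕ} (h : q + p = q + p) (h' : p + q = q + p)
    (b : Basis (Fin (q + p)) ℝ T) (β : T [⋀^Fin p]→ₗ[ℝ] N) (w : Fin p → T) :
    wedge (insertLast h h' b.det w) β b = β w := by
  -- Both sides are alternating in `w`, so that distinct basis vectors may be taken for `w`.
  let f : T [⋀^Fin p]→ₗ[ℝ] N :=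
    ∑ σ : Equiv.Perm (Fin (q + p)),
      (((q.factorial : ℝ) * p.factorial)⁻¹ * ((Equiv.Perm.sign σ : ℤ) : ℝ)) •
        (LinearMap.toSpanSingleton ℝ N (β fun j => b (σ (Fin.natAdd q j)))).compAlternatingMap
          (insertFirst h b.det fun i => b (σ (Fin.castAdd p i)))
  have hf : ∀ w, f w = wedge (insertLast h h' b.det w) β b := by
    intro w
    rw [wedge_apply]
    simp only [f, alternatingMap_sum_apply, AlternatingMap.smul_apply]
    refine Finset.sum_congr rfl fun σ _ => ?_
    rw [insertLast_apply]
    rfl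
  rw [← hf]
  congr 1
  refine Basis.ext_alternating b fun k hk => ?_
  obtain ⟨τ, hτ⟩ := exists_perm_extend k hk
  rw [hf]
  have e1 : (b : Fin (q + p) → T) = (b ∘ τ) ∘ (τ⁻¹ : Equiv.Perm _) := by
    funext i
    simp
  have e2 : ∀ j, (b ∘ τ) (Fin.natAdd q j) = b (k j) := fun j => by simp [hτ]
  have e3 : b.det (b ∘ τ) = ((Equiv.Perm.sign τ : ℤ) : ℝ) := by
    rw [AlternatingMap.map_perm, Basis.det_self, Units.smul_def, zsmul_eq_mul, mul_one]
  have e4 : wedge (insertLast h h' b.det fun i => b (k i)) β b = Equiv.Perm.sign τ •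
      wedge (insertLast h h' b.det fun i => b (k i)) β (b ∘ τ) := by
    conv_lhs => arg 2; rw [e1]
    rw [AlternatingMap.map_perm, Equiv.Perm.sign_inv]
  rw [e4, wedge_apply_of_forall_eq_zero]
  · simp only [e2]
    rw [insertLast_apply]
    have : (fun i => Fin.append (fun i => (b ∘ τ) (Fin.castAdd p i)) (fun i => b (k i))
        (Fin.cast h.symm i)) = b ∘ τ := by
      simp only [← e2]
      exact Fin.append_castAdd_natAdd
    rw [this, e3, Units.smul_def, ← Int.cast_smul_eq_zsmul ℝ, smul_smul,
      ← Int.cast_mul, ← Units.val_mul, Int.units_mul_self]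
    simp
  · intro v i j hv
    rw [insertLast_apply]
    refine AlternatingMap.map_eq_zero_of_eq _ _ (i := Fin.castAdd p i) (j := Fin.natAdd q j) ?_ ?_
    · simp only [Fin.cast_eq_self, Fin.append_left, Fin.append_right]
      rw [hv, e2]
    · intro e
      have := congrArg Fin.val e
      simp at this
      omega

/-- A sum over multi-indices weighted by a determinant is a signed sum over permutations. -/
theorem sum_det_smul {n : ℕ} (b : Basis (Fin n) ℝ T) (G : (Fin n → T) → N) :
    ∑ r : Fin n → Fin n, b.det (fun k => b (r k)) • G (fun k => b (r k)) =
      ∑ σ : Equiv.Perm (Fin n), Equiv.Perm.sign σ • G (fun k => b (σ k)) := by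
  symm
  refine Fintype.sum_of_injective (fun σ : Equiv.Perm (Fin n) => (σ : Fin n → Fin n))
    DFunLike.coe_injective _ _ (fun r hr => ?_) (fun σ => ?_)
  · have hr' : ¬ Function.Injective r := fun hi =>
      hr ⟨Equiv.ofBijective r (Finite.injective_iff_bijective.1 hi), rfl⟩
    simp only [Function.Injective, not_forall] at hr'
    obtain ⟨i, j, hij, hne⟩ := hr'
    rw [AlternatingMap.map_eq_zero_of_eq b.det _ (by rw [hij]) hne, zero_smul]
  · have : b.det (fun k => b (σ k)) = ((Equiv.Perm.sign σ : ℤ) : ℝ) := by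
      change b.det (b ∘ σ) = _
      rw [AlternatingMap.map_perm, Basis.det_self, Units.smul_def, zsmul_eq_mul, mul_one]
    rw [this, Int.cast_smul_eq_zsmul, Units.smul_def]

/-- The double contraction of the volume form with a `p`-form, which governs `**`. By
`sum_det_smul` it is the alternatization that computes `vol (·, w) ∧ β` at `b`. -/
theorem sum_det_append_smul {p q n : ℕ} (h : p + q = n) (h' : q + p = n)
    (b : Basis (Fin n) ℝ T) (β : T [⋀^Fin p]→ₗ[ℝ] N) (w : Fin p → T) :
    ∑ j : Fin q → Fin n, ∑ i : Fin p → Fin n,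
      (b.det (fun k => Fin.append (fun a => b (j a)) w (Fin.cast h'.symm k)) *
        b.det (fun k => Fin.append (fun a => b (i a)) (fun a => b (j a)) (Fin.cast h.symm k))) •
          β (fun a => b (i a)) =
      (((blockSign h h' : ℤ) : ℝ) * ((q.factorial : ℝ) * p.factorial)) • β w := by
  subst h'
  have e0 := wedge_insertLast_det rfl h b β w
  have e1 := congrArg (fun f => f b) (factorial_smul_wedge (insertLast rfl h b.det w) β)
  simp only [AlternatingMap.smul_apply, e0, MultilinearMap.alternatization_apply,
    MultilinearMap.domDomCongr_apply] at e1
  rw [mul_smul, e1, ← sum_det_smul b, ← (Fin.appendEquiv q p).sum_comp, Fintype.sum_prod_type,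
    Finset.smul_sum]
  refine Finset.sum_congr rfl fun j _ => ?_
  rw [Finset.smul_sum]
  refine Finset.sum_congr rfl fun i _ => ?_
  have e2 : (fun k => b ((Fin.appendEquiv q p) (j, i) k)) =
      Fin.append (fun a => b (j a)) (fun a => b (i a)) := by
    funext k
    refine Fin.addCases (fun a => ?_) (fun a => ?_) k <;> simp [Fin.appendEquiv]
  rw [e2, map_append_swap h rfl b.det, smulProd_apply]
  simp only [Fin.append_left, Fin.append_right]
  change _ = _ • _ • (insertLast rfl h b.det w _ • β _)
  rw [insertLast_apply, smul_smul, smul_smul, Units.smul_def, zsmul_eq_mul]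
  congr 1
  simp only [Fin.cast_eq_self]
  ring

end HodgeAlgebra

/-! ### The Hodge star of a nondegenerate form -/

section HodgeMetric

open Module

variable {T N : Type*} [AddCommGroup T] [Module ℝ T] [AddCommGroup N] [Module ℝ N]

/-- The element `∑ b_i ⊗ b♯_i`, raised to the power `p`, does not depend on the basis. -/
theorem sum_dualBasis_smul {n p : ℕ} (g : LinearMap.BilinForm ℝ T) (hg : g.Nondegenerate)
    (b c : Basis (Fin n) ℝ T) (f : MultilinearMap ℝ (fun _ : Fin p => T) ℝ)
    (h : MultilinearMap ℝ (fun _ : Fin p => T) N) :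
    ∑ i : Fin p → Fin n, f (fun k => b (i k)) • h (fun k => g.dualBasis hg b (i k)) =
      ∑ i : Fin p → Fin n, f (fun k => c (i k)) • h (fun k => g.dualBasis hg c (i k)) := by
  have e1 : ∀ i, c i = ∑ k, g (g.dualBasis hg b k) (c i) • b k := by
    intro i
    conv_lhs => rw [← b.sum_repr (c i)]
    refine Finset.sum_congr rfl fun k _ => ?_
    congr 1
    conv_rhs => rw [← b.sum_repr (c i)]
    simp only [map_sum, map_smul, LinearMap.BilinForm.apply_dualBasis_left, smul_eq_mul, mul_ite,
      mul_one, mul_zero, Finset.sum_ite_eq', Finset.mem_univ, if_true]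
  have e2 : ∀ k, g.dualBasis hg b k = ∑ i, g (g.dualBasis hg b k) (c i) • g.dualBasis hg c i := by
    intro k
    conv_lhs => rw [← (g.dualBasis hg c).sum_repr (g.dualBasis hg b k)]
    simp only [LinearMap.BilinForm.dualBasis_repr_apply]
  have e3 : ∀ i : Fin p → Fin n, f (fun a => c (i a)) =
      ∑ r : Fin p → Fin n, (∏ a, g (g.dualBasis hg b (r a)) (c (i a))) • f (fun a => b (r a)) := by
    intro i
    conv_lhs => rw [funext fun a => e1 (i a)]
    rw [MultilinearMap.map_sum]
    exact Finset.sum_congr rfl fun r _ => f.map_smul_univ _ _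
  have e4 : ∀ r : Fin p → Fin n, h (fun a => g.dualBasis hg b (r a)) =
      ∑ i : Fin p → Fin n, (∏ a, g (g.dualBasis hg b (r a)) (c (i a))) •
        h (fun a => g.dualBasis hg c (i a)) := by
    intro r
    conv_lhs => rw [funext fun a => e2 (r a)]
    rw [MultilinearMap.map_sum]
    exact Finset.sum_congr rfl fun i _ => h.map_smul_univ _ _
  simp only [e3, e4, Finset.sum_smul, Finset.smul_sum]
  rw [Finset.sum_comm]
  refine Finset.sum_congr rfl fun i _ => Finset.sum_congr rfl fun r _ => ?_
  rw [smul_smul, smul_eq_mul, mul_comm]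

/-- The Gram determinant of a basis. -/
noncomputable def gramDet {n : ℕ} (b : Fin n → T) (g : LinearMap.BilinForm ℝ T) : ℝ :=
  (Matrix.of fun i j => g (b i) (b j)).det

theorem gramDet_eq {n : ℕ} (b c : Basis (Fin n) ℝ T) (g : LinearMap.BilinForm ℝ T) :
    gramDet c g = b.det c ^ 2 * gramDet b g := by
  have h : ∀ b : Basis (Fin n) ℝ T, gramDet b g = (LinearMap.BilinForm.toMatrix b g).det := by
    intro b
    rw [gramDet]
    congr 1
    ext i j
    simp [LinearMap.BilinForm.toMatrix_apply]
  rw [h, h, ← LinearMap.BilinForm.toMatrix_mul_basis_toMatrix b c, Matrix.det_mul, Matrix.det_mul,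
    Matrix.det_transpose, Basis.det_apply]
  ring

theorem gramDet_ne_zero {n : ℕ} (b : Basis (Fin n) ℝ T) (g : LinearMap.BilinForm ℝ T)
    (hg : g.Nondegenerate) : gramDet b g ≠ 0 := by
  have h : gramDet b g = (LinearMap.BilinForm.toMatrix b g).det := by
    rw [gramDet]
    congr 1
    ext i j
    simp [LinearMap.BilinForm.toMatrix_apply]
  rw [h]
  exact (LinearMap.BilinForm.nondegenerate_iff_det_ne_zero b).1 hg

theorem det_dualBasis {n : ℕ} (b : Basis (Fin n) ℝ T) (g : LinearMap.BilinForm ℝ T)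
    (hg : g.Nondegenerate) : b.det (g.dualBasis hg b) = (gramDet b g)⁻¹ := by
  have h1 : (g.dualBasis hg b).det b = gramDet b g := by
    rw [Basis.det_apply, gramDet, ← Matrix.det_transpose]
    congr 1
    ext i j
    simp [Basis.toMatrix_apply, LinearMap.BilinForm.dualBasis_repr_apply]
  have h2 : b.det (g.dualBasis hg b) * (g.dualBasis hg b).det b = 1 := by
    rw [Basis.det_mul_det, Basis.det_self]
  rw [h1] at h2
  exact eq_inv_of_mul_eq_one_left h2

open scoped Classical in
/-- The sign `±1` of a basis with respect to an orientation. -/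
noncomputable def orientSign {n : ℕ} (b : Basis (Fin n) ℝ T) (o : Orientation ℝ T (Fin n)) : ℝ :=
  if b.orientation = o then (1 : ℝ) else -1

theorem orientSign_mul_self {n : ℕ} (b : Basis (Fin n) ℝ T) (o : Orientation ℝ T (Fin n)) :
    orientSign b o * orientSign b o = 1 := by
  unfold orientSign
  split_ifs <;> norm_num

theorem volumeForm_eq_smul_det {n : ℕ} (b : Basis (Fin n) ℝ T) (g : LinearMap.BilinForm ℝ T)
    (o : Orientation ℝ T (Fin n)) :
    volumeForm b g o = (orientSign b o * Real.sqrt |gramDet b g|) • b.det := rfl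

theorem orientSign_eq {n : ℕ} (b c : Basis (Fin n) ℝ T) (o : Orientation ℝ T (Fin n)) :
    orientSign c o * |b.det c| = orientSign b o * b.det c := by
  have hd : b.det c ≠ 0 := (b.isUnit_det c).ne_zero
  by_cases hpos : 0 < b.det c
  · rw [abs_of_pos hpos]
    have := (b.orientation_eq_iff_det_pos c).2 hpos
    rw [orientSign, orientSign, this]
  · have hneg : b.det c < 0 := lt_of_le_of_ne (not_lt.1 hpos) hd
    have hne : c.orientation ≠ b.orientation := fun e =>
      hpos ((b.orientation_eq_iff_det_pos c).1 e.symm)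
    have hcb : c.orientation = -b.orientation := (b.orientation_ne_iff_eq_neg _).1 hne
    have hbne : ¬ (-b.orientation = b.orientation) := fun e => hne (hcb.trans e)
    rw [abs_of_neg hneg]
    rcases b.orientation_eq_or_eq_neg o with ho | ho
    · subst ho
      simp [orientSign, hcb, hbne]
    · subst ho
      have : ¬ (b.orientation = -b.orientation) := fun e => hbne e.symm
      simp [orientSign, hcb, this]

/-- The volume form does not depend on the basis. -/
theorem volumeForm_eq {n : ℕ} (b c : Basis (Fin n) ℝ T) (g : LinearMap.BilinForm ℝ T)
    (o : Orientation ℝ T (Fin n)) : volumeForm b g o = volumeForm c g o := by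
  have hb : b.det = b.det c • c.det := AlternatingMap.eq_smul_basis_det c b.det
  have hsign := orientSign_eq b c o
  set d := b.det c with hd
  rw [volumeForm_eq_smul_det, volumeForm_eq_smul_det, gramDet_eq b c, abs_mul, abs_pow,
    Real.sqrt_mul (by positivity), Real.sqrt_sq (abs_nonneg _), ← mul_assoc, ← hd, hsign, hb,
    smul_smul]
  congr 1
  ring

theorem hodgeStar_apply {p q n : ℕ} (h : p + q = n) (b : Basis (Fin n) ℝ T)
    (g : LinearMap.BilinForm ℝ T) (hg : g.Nondegenerate) (o : Orientation ℝ T (Fin n))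
    (β : T [⋀^Fin p]→ₗ[ℝ] N) (v : Fin q → T) :
    hodgeStar h b g hg o β v = ((p.factorial : ℝ)⁻¹) • ∑ i : Fin p → Fin n,
      volumeForm b g o (fun k => Fin.append (fun a => b (i a)) v (Fin.cast h.symm k)) •
        β (fun a => g.dualBasis hg b (i a)) := by
  rw [hodgeStar, AlternatingMap.smul_apply, alternatingMap_sum_apply]
  rfl

/-- The Hodge star does not depend on the basis. -/
theorem hodgeStar_eq {p q n : ℕ} (h : p + q = n) (b c : Basis (Fin n) ℝ T)
    (g : LinearMap.BilinForm ℝ T) (hg : g.Nondegenerate) (o : Orientation ℝ T (Fin n))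
    (β : T [⋀^Fin p]→ₗ[ℝ] N) : hodgeStar h b g hg o β = hodgeStar h c g hg o β := by
  ext v
  have h' : q + p = n := by omega
  rw [hodgeStar_apply, hodgeStar_apply, volumeForm_eq b c]
  simp only [← insertLast_apply h h']
  congr 1
  exact sum_dualBasis_smul g hg b c (insertLast h h' (volumeForm c g o) v).toMultilinearMap
    β.toMultilinearMap

theorem hodgeStar_smul {p q n : ℕ} (h : p + q = n) (b : Basis (Fin n) ℝ T)
    (g : LinearMap.BilinForm ℝ T) (hg : g.Nondegenerate) (o : Orientation ℝ T (Fin n)) (r : ℝ)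
    (β : T [⋀^Fin p]→ₗ[ℝ] N) : hodgeStar h b g hg o (r • β) = r • hodgeStar h b g hg o β := by
  ext v
  rw [AlternatingMap.smul_apply, hodgeStar_apply, hodgeStar_apply, smul_comm r,
    Finset.smul_sum (r := r)]
  congr 1
  refine Finset.sum_congr rfl fun i _ => ?_
  rw [AlternatingMap.smul_apply, smul_comm r]

/-- `** = ±1`, where the sign is `(-1)^(pq)` times the sign of the Gram determinant. -/
theorem hodgeStar_hodgeStar {p q n : ℕ} (h : p + q = n) (h' : q + p = n) (b : Basis (Fin n) ℝ T)
    (g : LinearMap.BilinForm ℝ T) (hg : g.Nondegenerate) (hs : g.IsSymm)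
    (o : Orientation ℝ T (Fin n)) (β : T [⋀^Fin p]→ₗ[ℝ] N) :
    hodgeStar h' b g hg o (hodgeStar h b g hg o β) =
      (((blockSign h h' : ℤ) : ℝ) * (|gramDet b g| * (gramDet b g)⁻¹)) • β := by
  ext w
  set D := gramDet b g with hD
  set b' := g.dualBasis hg b with hb'
  set k := orientSign b o * Real.sqrt |D| with hk
  have hkk : k * k = |D| := by
    have := orientSign_mul_self b o
    have h3 := Real.mul_self_sqrt (abs_nonneg D)
    rw [hk]
    linear_combination (Real.sqrt |D| * Real.sqrt |D|) * this + h3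
  have hvol : volumeForm b g o = k • b.det := volumeForm_eq_smul_det b g o
  -- The two factors of `∑ b_i ⊗ b♯_i` may be exchanged, as `b♯♯ = b`.
  have e1 : ∀ v : Fin q → T, ∑ i : Fin p → Fin n,
      b.det (fun k => Fin.append (fun a => b (i a)) v (Fin.cast h.symm k)) •
        β (fun a => b' (i a)) = ∑ i : Fin p → Fin n,
      b.det (fun k => Fin.append (fun a => b' (i a)) v (Fin.cast h.symm k)) •
        β (fun a => b (i a)) := by
    intro v
    simp only [← insertLast_apply h h']
    have := sum_dualBasis_smul g hg b b' (insertLast h h' b.det v).toMultilinearMap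
      β.toMultilinearMap
    rw [hb', LinearMap.BilinForm.dualBasis_dualBasis hg hs b] at this
    exact this
  have e2 : ∀ r : Fin n → Fin n, b.det (fun k => b' (r k)) = D⁻¹ * b.det (fun k => b (r k)) := by
    intro r
    have h4 := congrArg (fun f => f (fun k => b (r k))) (AlternatingMap.eq_smul_basis_det b
      (b.det.compLinearMap (b.equiv b' (Equiv.refl _)).toLinearMap))
    simp only [AlternatingMap.smul_apply, AlternatingMap.compLinearMap_apply,
      LinearEquiv.coe_coe, Basis.equiv_apply, Equiv.refl_apply, smul_eq_mul] at h4
    have h5 : b.det (fun i => b' i) = D⁻¹ := det_dualBasis b g hg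
    rw [h5] at h4
    exact h4
  have e3 : ∀ (i : Fin p → Fin n) (j : Fin q → Fin n),
      b.det (fun k => Fin.append (fun a => b' (i a)) (fun a => b' (j a)) (Fin.cast h.symm k)) =
      D⁻¹ * b.det (fun k => Fin.append (fun a => b (i a)) (fun a => b (j a)) (Fin.cast h.symm k)) :=
    by
    intro i j
    have h6 : ∀ c : Fin n → T, (fun k => Fin.append (fun a => c (i a)) (fun a => c (j a))
        (Fin.cast h.symm k)) = fun k => c (Fin.append i j (Fin.cast h.symm k)) := by
      intro c
      funext k
      obtain ⟨k, rfl⟩ := (finCongr h).surjective k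
      refine Fin.addCases (fun i => ?_) (fun i => ?_) k <;> simp
    rw [h6 b', h6 b, e2]
  have e4 := sum_det_append_smul h h' b β w
  rw [hodgeStar_apply]
  simp only [hodgeStar_apply, hvol, AlternatingMap.smul_apply, smul_assoc, ← Finset.smul_sum]
  rw [← hb']
  simp only [e1, e3]
  have e5 : ∑ j : Fin q → Fin n,
      b.det (fun k => Fin.append (fun a => b (j a)) w (Fin.cast h'.symm k)) •
        (p.factorial : ℝ)⁻¹ • k • ∑ i : Fin p → Fin n, (D⁻¹ *
          b.det (fun k => Fin.append (fun a => b (i a)) (fun a => b (j a)) (Fin.cast h.symm k))) •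
            β (fun a => b (i a)) = ((p.factorial : ℝ)⁻¹ * k * D⁻¹) •
      ((((blockSign h h' : ℤ) : ℝ) * ((q.factorial : ℝ) * p.factorial)) • β w) := by
    rw [← e4]
    simp only [Finset.smul_sum, smul_smul]
    refine Finset.sum_congr rfl fun j _ => Finset.sum_congr rfl fun i _ => ?_
    congr 1
    ring
  rw [e5]
  simp only [smul_smul]
  congr 1
  have hp : (p.factorial : ℝ) ≠ 0 := by positivity
  have hq : (q.factorial : ℝ) ≠ 0 := by positivity
  rw [← hkk]
  field_simp

end HodgeMetric

/-! ### Coordinate vector fields -/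

section CoordinateFields

variable {n : ℕ} {M : Type*} [TopologicalSpace M]
  [ChartedSpace (EuclideanSpace ℝ (Fin n)) M] [IsManifold (𝓡 n) ∞ M]

local notation "𝔼" => EuclideanSpace ℝ (Fin n)

/-- The vector field with constant coefficients `v` in the chart at `x`. The tangent space `T_x M` is
the model space, and `v` is its own coefficient vector there. -/
noncomputable abbrev coordField (x : M) (v : 𝔼) : Π y : M, TangentSpace (𝓡 n) y :=
  constExt 𝔼 (x := x) (v : TangentSpace (𝓡 n) x)

theorem isManifold_one : IsManifold (𝓡 n) 1 M := IsManifold.of_le (n := ∞) (by simp)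

/-- `constExt` on the tangent bundle is the coordinate vector field of the chart at `x`. -/
theorem constExt_eq_mfderiv_symm {x y : M} (hy : y ∈ (chartAt 𝔼 x).source)
    (v : 𝔼) :
    coordField x v y = mfderiv 𝓘(ℝ, 𝔼) (𝓡 n) (extChartAt (𝓡 n) x).symm (extChartAt (𝓡 n) x y) v := by
  have : IsManifold (𝓡 n) 1 M := isManifold_one
  have h1 := TangentBundle.symmL_trivializationAt (I := 𝓡 n) hy
  have h2 := TangentBundle.continuousLinearMapAt_trivializationAt (I := 𝓡 n)
    (mem_chart_source 𝔼 x)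
  rw [mfderiv_extChartAt_self] at h2
  have h3 : (trivializationAt 𝔼 (TangentSpace (𝓡 n)) x).linearMapAt ℝ x v = v := by
    have := congrArg (fun L => L v) h2
    exact this
  change (trivializationAt 𝔼 (TangentSpace (𝓡 n)) x).symmₗ ℝ y
    ((trivializationAt 𝔼 (TangentSpace (𝓡 n)) x).linearMapAt ℝ x v) = _
  rw [h3]
  have h4 := congrArg (fun L => L v) h1
  simp only [ModelWithCorners.range_eq_univ, mfderivWithin_univ] at h4
  exact h4

/-- The derivative along a coordinate field is a partial derivative in the chart. -/
theorem mfderiv_constExt {x z : M} (hz : z ∈ (chartAt 𝔼 x).source) (v : 𝔼)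
    {f : M → ℝ} (hf : MDifferentiableAt (𝓡 n) 𝓘(ℝ) f z) :
    mfderiv (𝓡 n) 𝓘(ℝ) f z (coordField x v z) =
      fderiv ℝ (f ∘ (extChartAt (𝓡 n) x).symm) (extChartAt (𝓡 n) x z) v := by
  have : IsManifold (𝓡 n) 1 M := isManifold_one
  have hz' : z ∈ (extChartAt (𝓡 n) x).source := by rwa [extChartAt_source]
  have h0 := (extChartAt (𝓡 n) x).left_inv hz'
  have h1 : MDifferentiableAt 𝓘(ℝ, 𝔼) (𝓡 n) (extChartAt (𝓡 n) x).symm (extChartAt (𝓡 n) x z) := by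
    have := mdifferentiableWithinAt_extChartAt_symm (I := 𝓡 n)
      ((extChartAt (𝓡 n) x).map_source hz')
    simpa [ModelWithCorners.range_eq_univ, mdifferentiableWithinAt_univ] using this
  let D : 𝔼 →L[ℝ] ℝ := mfderiv (𝓡 n) 𝓘(ℝ) f z
  have h2 : HasMFDerivAt (𝓡 n) 𝓘(ℝ) f ((extChartAt (𝓡 n) x).symm (extChartAt (𝓡 n) x z)) D := by
    rw [h0]
    exact hf.hasMFDerivAt
  let A : 𝔼 →L[ℝ] 𝔼 :=
    mfderiv 𝓘(ℝ, 𝔼) (𝓡 n) (extChartAt (𝓡 n) x).symm (extChartAt (𝓡 n) x z)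
  have h3 : HasFDerivAt (f ∘ (extChartAt (𝓡 n) x).symm) (D.comp A) (extChartAt (𝓡 n) x z) :=
    hasMFDerivAt_iff_hasFDerivAt.1 (h2.comp _ h1.hasMFDerivAt)
  rw [constExt_eq_mfderiv_symm hz]
  exact (congrArg (fun L : 𝔼 →L[ℝ] ℝ => L v) h3.fderiv).symm

theorem contDiffAt_comp_extChartAt_symm {x z : M} (hz : z ∈ (chartAt 𝔼 x).source) {f : M → ℝ}
    (hf : ContMDiffAt (𝓡 n) 𝓘(ℝ) ∞ f z) :
    ContDiffAt ℝ ∞ (f ∘ (extChartAt (𝓡 n) x).symm) (extChartAt (𝓡 n) x z) := by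
  have hz' : z ∈ (extChartAt (𝓡 n) x).source := by rwa [extChartAt_source]
  have h0 := (extChartAt (𝓡 n) x).left_inv hz'
  rw [← contMDiffAt_iff_contDiffAt]
  refine ContMDiffAt.comp (I' := 𝓡 n) _ (by rwa [h0]) ?_
  exact (contMDiffOn_extChartAt_symm x).contMDiffAt
    ((isOpen_extChartAt_target (I := 𝓡 n) x).mem_nhds ((extChartAt (𝓡 n) x).map_source hz'))

theorem extChartAt_symm_tendsto {x z : M} (hz : z ∈ (chartAt 𝔼 x).source) :
    Filter.Tendsto (extChartAt (𝓡 n) x).symm (𝓝 (extChartAt (𝓡 n) x z)) (𝓝 z) := by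
  have hz' : z ∈ (extChartAt (𝓡 n) x).source := by rwa [extChartAt_source]
  have h0 := (extChartAt (𝓡 n) x).left_inv hz'
  have := (continuousOn_extChartAt_symm (I := 𝓡 n) x).continuousAt
    ((isOpen_extChartAt_target (I := 𝓡 n) x).mem_nhds ((extChartAt (𝓡 n) x).map_source hz'))
  rw [ContinuousAt, h0] at this
  exact this

theorem eventually_mvfderiv_constExt {x z : M} (hz : z ∈ (chartAt 𝔼 x).source)
    (v : 𝔼) {f : M → ℝ} (hf : ContMDiffAt (𝓡 n) 𝓘(ℝ) ∞ f z) :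
    ∀ᶠ y in 𝓝 z, mvfderiv (𝓡 n) f y (coordField x v y) =
      fderiv ℝ (f ∘ (extChartAt (𝓡 n) x).symm) (extChartAt (𝓡 n) x y) v := by
  have : IsManifold (𝓡 n) 1 M := isManifold_one
  filter_upwards [(contMDiffAt_iff_contMDiffAt_nhds (n := 1) (by simp)).1 (hf.of_le (by simp)),
    (chartAt 𝔼 x).open_source.mem_nhds hz] with y hy hyx
  exact mfderiv_constExt hyx v (hy.mdifferentiableAt (by simp))

theorem contMDiffAt_mvfderiv_constExt {x z : M} (hz : z ∈ (chartAt 𝔼 x).source)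
    (v : 𝔼) {f : M → ℝ} (hf : ContMDiffAt (𝓡 n) 𝓘(ℝ) ∞ f z) :
    ContMDiffAt (𝓡 n) 𝓘(ℝ) ∞ (fun y => mvfderiv (𝓡 n) f y (coordField x v y)) z := by
  refine ContMDiffAt.congr_of_eventuallyEq ?_ (eventually_mvfderiv_constExt hz v hf)
  have h1 := ((contDiffAt_comp_extChartAt_symm hz hf).fderiv_right (m := ∞) (by simp)).clm_apply
    (contDiffAt_const (c := (v : 𝔼)))
  exact ContMDiffAt.comp (I' := 𝓘(ℝ, 𝔼)) z h1.contMDiffAt (contMDiffAt_extChartAt' hz)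

/-- Second derivatives along coordinate vector fields are symmetric. -/
theorem mvfderiv_mvfderiv_constExt_comm {x z : M} (hz : z ∈ (chartAt 𝔼 x).source)
    (v w : 𝔼) {f : M → ℝ} (hf : ContMDiffAt (𝓡 n) 𝓘(ℝ) ∞ f z) :
    mvfderiv (𝓡 n) (fun y => mvfderiv (𝓡 n) f y (coordField x v y)) z (coordField x w z) =
      mvfderiv (𝓡 n) (fun y => mvfderiv (𝓡 n) f y (coordField x w y)) z (coordField x v z) := by
  set φ := extChartAt (𝓡 n) x with hφ
  have hz' : z ∈ φ.source := by rwa [hφ, extChartAt_source]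
  have hc := contDiffAt_comp_extChartAt_symm hz hf
  have key : ∀ v w : 𝔼,
      mvfderiv (𝓡 n) (fun y => mvfderiv (𝓡 n) f y (coordField x v y)) z (coordField x w z) =
      fderiv ℝ (fderiv ℝ (f ∘ φ.symm)) (φ z) w v := by
    intro v w
    have h1 := mfderiv_constExt hz w
      ((contMDiffAt_mvfderiv_constExt hz v hf).mdifferentiableAt (by simp))
    refine h1.trans ?_
    have h2 : ((fun y => mvfderiv (𝓡 n) f y (coordField x v y)) ∘ φ.symm) =ᶠ[𝓝 (φ z)]
        fun u => fderiv ℝ (f ∘ φ.symm) u v := by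
      filter_upwards [(extChartAt_symm_tendsto hz).eventually
        (eventually_mvfderiv_constExt hz v hf),
        (isOpen_extChartAt_target (I := 𝓡 n) x).mem_nhds (φ.map_source hz')] with u hu hut
      refine hu.trans ?_
      rw [φ.right_inv hut]
    have h3 : DifferentiableAt ℝ (fderiv ℝ (f ∘ φ.symm)) (φ z) :=
      (hc.fderiv_right (m := 1) (by norm_num; exact ENat.LEInfty.out)).differentiableAt (by simp)
    rw [← hφ, h2.fderiv_eq]
    have h4 := ((ContinuousLinearMap.apply ℝ ℝ v).hasFDerivAt.comp _ h3.hasFDerivAt).fderiv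
    exact congrArg (fun L : 𝔼 →L[ℝ] ℝ => L w) h4
  rw [key, key]
  have hsymm : IsSymmSndFDerivAt ℝ (f ∘ φ.symm) (φ z) :=
    hc.isSymmSndFDerivAt (by simpa using ENat.LEInfty.out)
  exact hsymm _ _

theorem contMDiffAt_constExt {F : Type*} [NormedAddCommGroup F] [NormedSpace ℝ F]
    {V : M → Type*} [TopologicalSpace (TotalSpace F V)]
    [∀ x, AddCommGroup (V x)] [∀ x, Module ℝ (V x)] [∀ x, TopologicalSpace (V x)]
    [∀ x, IsTopologicalAddGroup (V x)] [∀ x, ContinuousSMul ℝ (V x)]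
    [FiberBundle F V] [VectorBundle ℝ F V] [ContMDiffVectorBundle ∞ F V (𝓡 n)] {x y : M}
    (hy : y ∈ (trivializationAt F V x).baseSet) (w : V x) :
    ContMDiffAt (𝓡 n) ((𝓡 n).prod 𝓘(ℝ, F)) ∞
      (fun y => (⟨y, constExt F w y⟩ : TotalSpace F V)) y :=
  (contMDiffOn_constExt w).contMDiffAt ((trivializationAt F V x).open_baseSet.mem_nhds hy)

/-- Coordinate vector fields commute, being pull-backs of constant fields on the model space. -/
theorem mlieBracket_constExt {x z : M} (hz : z ∈ (chartAt 𝔼 x).source)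
    (v w : 𝔼) :
    mlieBracket (𝓡 n) (coordField x v) (coordField x w) z = 0 := by
  have : IsManifold (𝓡 n) 1 M := isManifold_one
  have : IsManifold (𝓡 n) (minSmoothness ℝ 3) M :=
    IsManifold.of_le (n := ∞) (by simpa using ENat.LEInfty.out)
  set φ := extChartAt (𝓡 n) x with hφ
  let K : 𝔼 → Π u : 𝔼, TangentSpace 𝓘(ℝ, 𝔼) u := fun v _ => v
  have hpull : ∀ v : 𝔼, mpullback (𝓡 n) 𝓘(ℝ, 𝔼) φ (K v) =ᶠ[𝓝 z]
      coordField x v := by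
    intro v
    filter_upwards [(chartAt 𝔼 x).open_source.mem_nhds hz] with y hy
    have hy' : y ∈ φ.source := by rwa [hφ, extChartAt_source]
    have h1 := mfderiv_extChartAt_comp_mfderivWithin_extChartAt_symm' (I := 𝓡 n) hy'
    have h2 := mfderivWithin_extChartAt_symm_comp_mfderiv_extChartAt' (I := 𝓡 n) hy'
    rw [ModelWithCorners.range_eq_univ, mfderivWithin_univ] at h1 h2
    rw [mpullback_apply, ContinuousLinearMap.inverse_eq h1 h2]
    exact (constExt_eq_mfderiv_symm hy v).symm
  have hconst : ∀ v : 𝔼, MDifferentiableAt 𝓘(ℝ, 𝔼) (𝓘(ℝ, 𝔼).prod 𝓘(ℝ, 𝔼))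
      (fun u : 𝔼 => (⟨u, K v u⟩ : TotalSpace 𝔼 (TangentSpace 𝓘(ℝ, 𝔼) (M := 𝔼)))) (φ z) := by
    intro v
    exact (contMDiffAt_vectorSpace_iff_contDiffAt (n := 1)).2
      (contDiffAt_const (c := v)) |>.mdifferentiableAt (by simp)
  have h3 := mpullback_mlieBracket (I := 𝓡 n) (I' := 𝓘(ℝ, 𝔼)) (n := ∞) (hconst v) (hconst w)
    (contMDiffAt_extChartAt' hz) (by simpa using ENat.LEInfty.out)
  rw [← (hpull v).mlieBracket_vectorField_eq (hpull w), ← h3, mpullback_apply]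
  have h4 : mlieBracket 𝓘(ℝ, 𝔼) (K v) (K w) (φ z) = 0 := by
    rw [← mlieBracketWithin_univ, mlieBracketWithin_eq_lieBracketWithin]
    change fderivWithin ℝ (fun _ : 𝔼 => w) Set.univ (φ z) v -
      fderivWithin ℝ (fun _ : 𝔼 => v) Set.univ (φ z) w = 0
    simp
  rw [h4, map_zero]

/-- A family of alternating maps on a finite-dimensional space is differentiable if all its values
are. -/
theorem differentiableAt_of_apply {p : ℕ} (ζ : 𝔼 → 𝔼 [⋀^Fin p]→L[ℝ] ℝ) (a : 𝔼)
    (h : ∀ u : Fin p → 𝔼, DifferentiableAt ℝ (fun z => ζ z u) a) : DifferentiableAt ℝ ζ a := by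
  have hfin : FiniteDimensional ℝ (𝔼 [⋀^Fin p]→L[ℝ] ℝ) := by
    let L : (𝔼 [⋀^Fin p]→L[ℝ] ℝ) →ₗ[ℝ] MultilinearMap ℝ (fun _ : Fin p => 𝔼) ℝ :=
      { toFun := fun f => f.toMultilinearMap
        map_add' := fun _ _ => rfl
        map_smul' := fun _ _ => rfl }
    refine FiniteDimensional.of_injective L fun f g hfg => ?_
    ext u
    exact congrArg (fun m => m u) hfg
  let b := (EuclideanSpace.basisFun (Fin n) ℝ).toBasis
  let Ψ : (𝔼 [⋀^Fin p]→L[ℝ] ℝ) →ₗ[ℝ] ((Fin p → Fin n) → ℝ) :=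
    { toFun := fun f r => f fun k => b (r k)
      map_add' := fun _ _ => rfl
      map_smul' := fun _ _ => rfl }
  have hΨ : LinearMap.ker Ψ = ⊥ := by
    refine LinearMap.ker_eq_bot.2 fun f g hfg => ?_
    refine ContinuousAlternatingMap.toAlternatingMap_injective ?_
    refine Module.Basis.ext_alternating b fun r _ => ?_
    exact congrFun hfg r
  obtain ⟨Φ, hΦ⟩ := Ψ.exists_leftInverse_of_injective hΨ
  have h1 : ζ = fun z => Φ.toContinuousLinearMap (Ψ (ζ z)) := by
    funext z
    exact (congrArg (fun L => L (ζ z)) hΦ).symm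
  rw [h1]
  refine Φ.toContinuousLinearMap.differentiableAt.comp a ?_
  exact differentiableAt_pi.2 fun r => h _

/-- The exterior derivative in terms of the coordinate fields of the chart at the base point. -/
theorem extDerivForm_apply {p : ℕ} (η : FormField n M p) (x : M)
    (hη : ∀ u : Fin p → 𝔼, MDifferentiableAt (𝓡 n) 𝓘(ℝ)
      (fun y => η y fun k => coordField x (u k) y) x) (v : Fin (p + 1) → 𝔼) :
    extDerivForm η x v = ∑ i : Fin (p + 1), (-1 : ℝ) ^ (i : ℕ) *
      mvfderiv (𝓡 n) (fun y => η y fun k => coordField x (v (i.succAbove k)) y) x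
        (coordField x (v i) x) := by
  set φ := extChartAt (𝓡 n) x with hφ
  have hx : x ∈ (chartAt 𝔼 x).source := mem_chart_source 𝔼 x
  have hx' : x ∈ φ.source := mem_extChartAt_source x
  set ζ : 𝔼 → 𝔼 [⋀^Fin p]→L[ℝ] ℝ := fun y => toContinuous (pullbackChart η x y) with hζ
  have h1 : ∀ u : Fin p → 𝔼, (fun z => ζ z u) =ᶠ[𝓝 (φ x)]
      (fun y => η y fun k => coordField x (u k) y) ∘ φ.symm := by
    intro u
    filter_upwards [(isOpen_extChartAt_target (I := 𝓡 n) x).mem_nhds (φ.map_source hx')] with z hz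
    have hz' : φ.symm z ∈ (chartAt 𝔼 x).source := by
      rw [← extChartAt_source (𝓡 n)]
      exact φ.map_target hz
    have h2 : ∀ k, coordField x (u k) (φ.symm z) = mfderiv 𝓘(ℝ, 𝔼) (𝓡 n) φ.symm z (u k) := by
      intro k
      have := constExt_eq_mfderiv_symm hz' (u k)
      rw [← hφ, φ.right_inv hz] at this
      exact this
    exact congrArg (η (φ.symm z)) (funext fun k => (h2 k).symm)
  have hcomp : ∀ u : Fin p → 𝔼, DifferentiableAt ℝ
      ((fun y => η y fun k => coordField x (u k) y) ∘ φ.symm) (φ x) := by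
    intro u
    rw [← mdifferentiableAt_iff_differentiableAt]
    have h0 : φ.symm (φ x) = x := φ.left_inv hx'
    refine MDifferentiableAt.comp (I' := 𝓡 n) _ (by rw [h0]; exact hη u) ?_
    have : IsManifold (𝓡 n) 1 M := isManifold_one
    have := mdifferentiableWithinAt_extChartAt_symm (I := 𝓡 n) (φ.map_source hx')
    rw [ModelWithCorners.range_eq_univ, mdifferentiableWithinAt_univ] at this
    exact this
  have hd : DifferentiableAt ℝ ζ (φ x) :=
    differentiableAt_of_apply ζ _ fun u => (hcomp u).congr_of_eventuallyEq (h1 u)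
  have h3 : extDerivForm η x v = extDeriv ζ (φ x) v := by
    have hself : mfderiv (𝓡 n) 𝓘(ℝ, 𝔼) φ x = ContinuousLinearMap.id ℝ 𝔼 := mfderiv_extChartAt_self
    have : extDerivForm η x v = extDeriv ζ (φ x) (fun k => mfderiv (𝓡 n) 𝓘(ℝ, 𝔼) φ x (v k)) := rfl
    rw [this, hself]
    rfl
  rw [h3, extDeriv_apply hd]
  refine Finset.sum_congr rfl fun i _ => ?_
  rw [zsmul_eq_mul, (h1 _).fderiv_eq]
  have h4 := mfderiv_constExt hx (v i) (hη (i.removeNth v))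
  push_cast
  congr 1
  exact h4.symm

end CoordinateFields

/-! ### Smoothness of the Hodge star -/

section MetricSmoothness

open Module

variable {n : ℕ} {M : Type*} [TopologicalSpace M]
  [ChartedSpace (EuclideanSpace ℝ (Fin n)) M]

local notation "𝔼" => EuclideanSpace ℝ (Fin n)

theorem contMDiffAt_det {k : ℕ} {A : M → Matrix (Fin k) (Fin k) ℝ} {x : M}
    (hA : ∀ i j, ContMDiffAt (𝓡 n) 𝓘(ℝ) ∞ (fun y => A y i j) x) :
    ContMDiffAt (𝓡 n) 𝓘(ℝ) ∞ (fun y => (A y).det) x := by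
  simp only [Matrix.det_apply']
  exact contMDiffAt_finsetSum fun σ _ =>
    contMDiffAt_const.mul (contMDiffAt_finsetProd fun i _ => hA _ _)

theorem contMDiffAt_matrix_inv {k : ℕ} {A : M → Matrix (Fin k) (Fin k) ℝ} {x : M}
    (hA : ∀ i j, ContMDiffAt (𝓡 n) 𝓘(ℝ) ∞ (fun y => A y i j) x) (hx : (A x).det ≠ 0)
    (i j : Fin k) : ContMDiffAt (𝓡 n) 𝓘(ℝ) ∞ (fun y => (A y)⁻¹ i j) x := by
  simp only [Matrix.inv_def, Ring.inverse_eq_inv', Matrix.smul_apply, smul_eq_mul,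
    Matrix.adjugate_apply]
  refine ((contMDiffAt_det hA).inv₀ hx).mul (contMDiffAt_det fun a b => ?_)
  by_cases h : a = j
  · subst h
    simpa using contMDiffAt_const
  · simpa [Matrix.updateRow_ne h] using hA a b

/-- The sign of a nonvanishing continuous function is locally constant. -/
theorem eventually_abs_mul_inv_eq {X : Type*} [TopologicalSpace X] {f : X → ℝ} {x : X}
    (hf : ContinuousAt f x) (hx : f x ≠ 0) :
    ∀ᶠ y in 𝓝 x, |f y| * (f y)⁻¹ = |f x| * (f x)⁻¹ := by
  rcases lt_or_gt_of_ne hx with h | h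
  · filter_upwards [hf.eventually_lt_const h] with y hy
    rw [abs_of_neg hy, abs_of_neg h, neg_mul, neg_mul, mul_inv_cancel₀ hy.ne, mul_inv_cancel₀ h.ne]
  · filter_upwards [hf.eventually_const_lt h] with y hy
    rw [abs_of_pos hy, abs_of_pos h, mul_inv_cancel₀ hy.ne', mul_inv_cancel₀ h.ne']

variable [IsManifold (𝓡 n) ∞ M]

/-- The basis of coordinate vectors at `y` of the chart at `x`. -/
noncomputable def coordBasis (x : M) {y : M}
    (hy : y ∈ (trivializationAt 𝔼 (TangentSpace (𝓡 n)) x).baseSet) :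
    Basis (Fin n) ℝ (TangentSpace (𝓡 n) y) :=
  (trivializationAt 𝔼 (TangentSpace (𝓡 n)) x).basisAt (EuclideanSpace.basisFun (Fin n) ℝ).toBasis hy

/-- The frame of coordinate vector fields of the chart at `x`. -/
noncomputable def coordFrame (x : M) (i : Fin n) : Π y : M, TangentSpace (𝓡 n) y :=
  (trivializationAt 𝔼 (TangentSpace (𝓡 n)) x).localFrame
    (EuclideanSpace.basisFun (Fin n) ℝ).toBasis i

theorem coordBasis_apply (x : M) {y : M}
    (hy : y ∈ (trivializationAt 𝔼 (TangentSpace (𝓡 n)) x).baseSet) (i : Fin n) :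
    coordBasis x hy i = coordFrame x i y :=
  (Trivialization.localFrame_apply_of_mem_baseSet _ _ hy).symm

theorem smoothFieldAt_coordFrame (x : M) (i : Fin n) : SmoothFieldAt (coordFrame x i) x :=
  contMDiffAt_localFrame_of_mem ∞ _ _ i (mem_baseSet_trivializationAt' x)

/-- Determinants of smooth vector fields with respect to the coordinate frame are smooth. The
coordinate frame is a basis on the chart domain only, whence the auxiliary function `f`. -/
theorem contMDiffAt_det_coordBasis (x : M) {X : Fin n → Π y : M, TangentSpace (𝓡 n) y}
    (hX : ∀ i, SmoothFieldAt (X i) x) : ∃ f : M → ℝ, ContMDiffAt (𝓡 n) 𝓘(ℝ) ∞ f x ∧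
      ∀ y hy, (coordBasis x (y := y) hy).det (fun i => X i y) = f y := by
  refine ⟨fun y => (Matrix.of fun i j => (trivializationAt 𝔼 (TangentSpace (𝓡 n)) x).localFrameCoeff
    (𝓡 n) (EuclideanSpace.basisFun (Fin n) ℝ).toBasis i y (X j y)).det,
    contMDiffAt_det fun i j => ?_, fun y hy => ?_⟩
  · exact contMDiffAt_localFrameCoeff _ (mem_baseSet_trivializationAt' x) (hX j) i
  · rw [Basis.det_apply]
    congr 1
    ext i j
    exact (Trivialization.localFrameCoeff_apply_of_mem_baseSet _ _ hy (X j) i).symm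

/-- The Gram determinant of the coordinate frame of the chart at `x`. -/
noncomputable def coordGramDet (g : PseudoRiemannianMetric n M) (x y : M) : ℝ :=
  gramDet (fun i => coordFrame x i y) (g.inner y)

theorem contMDiffAt_coordGramDet (g : PseudoRiemannianMetric n M) (x : M) :
    ContMDiffAt (𝓡 n) 𝓘(ℝ) ∞ (coordGramDet g x) x :=
  contMDiffAt_det fun i j =>
    g.smooth x _ _ (smoothFieldAt_coordFrame x i) (smoothFieldAt_coordFrame x j)

theorem coordGramDet_eq (g : PseudoRiemannianMetric n M) (x : M) {y : M}
    (hy : y ∈ (trivializationAt 𝔼 (TangentSpace (𝓡 n)) x).baseSet) :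
    coordGramDet g x y = gramDet (coordBasis x hy) (g.inner y) := by
  rw [coordGramDet]
  congr 1
  funext i
  exact (coordBasis_apply x hy i).symm

theorem coordGramDet_ne_zero (g : PseudoRiemannianMetric n M) (x : M) {y : M}
    (hy : y ∈ (trivializationAt 𝔼 (TangentSpace (𝓡 n)) x).baseSet) : coordGramDet g x y ≠ 0 := by
  rw [coordGramDet_eq g x hy]
  exact gramDet_ne_zero _ _ (g.nondegenerate y)

/-- The sign of the metric determinant is locally constant. -/
theorem eventually_gramDet_sign_eq (g : PseudoRiemannianMetric n M) (x : M) :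
    ∀ᶠ y in 𝓝 x, |gramDet (tangentBasis y) (g.inner y)| * (gramDet (tangentBasis y) (g.inner y))⁻¹ =
      |gramDet (tangentBasis x) (g.inner x)| * (gramDet (tangentBasis x) (g.inner x))⁻¹ := by
  have key : ∀ y, y ∈ (trivializationAt 𝔼 (TangentSpace (𝓡 n)) x).baseSet →
      |gramDet (tangentBasis y) (g.inner y)| * (gramDet (tangentBasis y) (g.inner y))⁻¹ =
      |coordGramDet g x y| * (coordGramDet g x y)⁻¹ := by
    intro y hy
    rw [coordGramDet_eq g x hy, gramDet_eq (tangentBasis y) (coordBasis x hy), abs_mul, mul_inv,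
      abs_of_nonneg (sq_nonneg ((tangentBasis y).det (coordBasis x hy)))]
    have : (tangentBasis y).det (coordBasis x hy) ^ 2 ≠ 0 :=
      pow_ne_zero _ ((tangentBasis y).isUnit_det (coordBasis x hy)).ne_zero
    field_simp
    rw [mul_div_mul_right _ _ (fun e => this (by rw [e]; ring))]
  have hx := mem_baseSet_trivializationAt' (F := 𝔼) (E := TangentSpace (𝓡 n) (M := M)) x
  filter_upwards [baseSet_mem_nhds (F := 𝔼) (V := TangentSpace (𝓡 n)) x,
    eventually_abs_mul_inv_eq (contMDiffAt_coordGramDet g x).continuousAt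
      (coordGramDet_ne_zero g x hx)] with y hy h
  rw [key y hy, key x hx, h]

/-- The coordinate frame has locally constant sign with respect to an orientation. -/
theorem eventually_orientSign_eq (o : ManifoldOrientation n M) (x : M) :
    ∃ c : ℝ, ∀ᶠ y in 𝓝 x, ∀ hy : y ∈ (trivializationAt 𝔼 (TangentSpace (𝓡 n)) x).baseSet,
      orientSign (coordBasis x hy) (o.orient y) = c := by
  obtain ⟨u, hu, s, hs, hso⟩ := o.locally_frame x
  have hsx : ∀ i, SmoothFieldAt (s i) x := fun i => (hs.contMDiffOn i).contMDiffAt hu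
  obtain ⟨f, hf, hfe⟩ := contMDiffAt_det_coordBasis x hsx
  have hsb : ∀ y (hyu : y ∈ u), (fun i => s i y) = hs.toBasisAt hyu := by
    intro y hyu
    funext i
    simp [IsLocalFrameOn.toBasisAt]
  have key : ∀ y (hy : y ∈ (trivializationAt 𝔼 (TangentSpace (𝓡 n)) x).baseSet), y ∈ u →
      f y ≠ 0 ∧ orientSign (coordBasis x hy) (o.orient y) = |f y| * (f y)⁻¹ := by
    intro y hy hyu
    have h1 := orientSign_eq (coordBasis x hy) (hs.toBasisAt hyu) (o.orient y)
    have h2 : f y = (coordBasis x hy).det (hs.toBasisAt hyu) := by rw [← hfe y hy, hsb y hyu]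
    have h3 : f y ≠ 0 := by
      rw [h2]
      exact ((coordBasis x hy).isUnit_det (hs.toBasisAt hyu)).ne_zero
    have h4 : orientSign (hs.toBasisAt hyu) (o.orient y) = 1 := if_pos (hso y hyu)
    rw [← h2, h4, one_mul] at h1
    exact ⟨h3, by rw [h1, mul_assoc, mul_inv_cancel₀ h3, mul_one]⟩
  have hx := mem_baseSet_trivializationAt' (F := 𝔼) (E := TangentSpace (𝓡 n) (M := M)) x
  refine ⟨|f x| * (f x)⁻¹, ?_⟩
  filter_upwards [hu, eventually_abs_mul_inv_eq hf.continuousAt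
    (key x hx (mem_of_mem_nhds hu)).1] with y hyu h hy
  rw [(key y hy hyu).2, h]

/-- The metric dual of the coordinate frame, written with the inverse Gram matrix. -/
noncomputable def coordDualFrame (g : PseudoRiemannianMetric n M) (x : M) (i : Fin n) :
    Π y : M, TangentSpace (𝓡 n) y := fun y =>
  ∑ k, (Matrix.of fun a b => g.inner y (coordFrame x a y) (coordFrame x b y))⁻¹ i k •
    coordFrame x k y

theorem smoothFieldAt_coordDualFrame (g : PseudoRiemannianMetric n M) (x : M) (i : Fin n) :
    SmoothFieldAt (coordDualFrame g x i) x := by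
  have hx := mem_baseSet_trivializationAt' (F := 𝔼) (E := TangentSpace (𝓡 n) (M := M)) x
  refine ContMDiffAt.sum_section fun k _ => ContMDiffAt.smul_section ?_
    (smoothFieldAt_coordFrame x k)
  exact contMDiffAt_matrix_inv (fun a b => g.smooth x _ _ (smoothFieldAt_coordFrame x a)
    (smoothFieldAt_coordFrame x b)) (coordGramDet_ne_zero g x hx) i k

theorem coordDualFrame_eq (g : PseudoRiemannianMetric n M) (x : M) {y : M}
    (hy : y ∈ (trivializationAt 𝔼 (TangentSpace (𝓡 n)) x).baseSet) (i : Fin n) :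
    coordDualFrame g x i y = (g.inner y).dualBasis (g.nondegenerate y) (coordBasis x hy) i := by
  set d := (g.inner y).dualBasis (g.nondegenerate y) (coordBasis x hy)
  set G := Matrix.of fun a b => g.inner y (coordFrame x a y) (coordFrame x b y) with hG
  have hdet : IsUnit G.det := (coordGramDet_ne_zero g x hy).isUnit
  refine d.repr.injective (Finsupp.ext fun j => ?_)
  rw [LinearMap.BilinForm.dualBasis_repr_apply, Basis.repr_self, coordBasis_apply, coordDualFrame,
    LinearMap.BilinForm.sum_left]
  have h := congrFun (congrFun (Matrix.nonsing_inv_mul G hdet) i) j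
  rw [Matrix.mul_apply, Matrix.one_apply] at h
  rw [Finsupp.single_apply, ← h]
  refine Finset.sum_congr rfl fun k _ => ?_
  rw [LinearMap.BilinForm.smul_left]
  rfl

/-- The Hodge star of a smooth form is smooth. -/
theorem IsSmoothForm.hodge (g : PseudoRiemannianMetric n M) (o : ManifoldOrientation n M)
    {p q : ℕ} (h : p + q = n) {β : FormField n M p} (hβ : IsSmoothForm β) :
    IsSmoothForm fun x => YMForms.hodge g o h x (β x) := by
  intro x X hX
  have hx := mem_baseSet_trivializationAt' (F := 𝔼) (E := TangentSpace (𝓡 n) (M := M)) x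
  obtain ⟨c, hc⟩ := eventually_orientSign_eq o x
  let Y : (Fin p → Fin n) → Fin n → Π y : M, TangentSpace (𝓡 n) y := fun i k y =>
    Fin.append (fun a => coordFrame x (i a) y) (fun b => X b y) (Fin.cast h.symm k)
  have hY : ∀ i k, SmoothFieldAt (Y i k) x := by
    intro i k
    obtain ⟨k', rfl⟩ : ∃ k', Fin.cast h k' = k := ⟨Fin.cast h.symm k, by simp⟩
    refine Fin.addCases (fun a => ?_) (fun b => ?_) k'
    · simpa [Y] using smoothFieldAt_coordFrame x (i a)
    · simpa [Y] using hX b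
  choose f hf hfe using fun i => contMDiffAt_det_coordBasis x (hY i)
  have hD : ContMDiffAt (𝓡 n) 𝓘(ℝ) ∞ (fun y => Real.sqrt |coordGramDet g x y|) x := by
    have hne := coordGramDet_ne_zero g x hx
    have h1 : ContDiffAt ℝ ∞ (fun t : ℝ => Real.sqrt |t|) (coordGramDet g x x) :=
      (contDiffAt_abs hne).sqrt (abs_ne_zero.2 hne)
    exact ContMDiffAt.comp (I' := 𝓘(ℝ)) (g := fun t : ℝ => Real.sqrt |t|) x h1.contMDiffAt
      (contMDiffAt_coordGramDet g x)
  have hmain : ContMDiffAt (𝓡 n) 𝓘(ℝ) ∞ (fun y => ((p.factorial : ℝ)⁻¹) *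
      ∑ i : Fin p → Fin n, (c * Real.sqrt |coordGramDet g x y|) * f i y *
        β y fun a => coordDualFrame g x (i a) y) x := by
    refine contMDiffAt_const.mul (contMDiffAt_finsetSum fun i _ => ?_)
    exact ((contMDiffAt_const.mul hD).mul (hf i)).mul
      (hβ x _ fun a => smoothFieldAt_coordDualFrame g x (i a))
  refine hmain.congr_of_eventuallyEq ?_
  filter_upwards [baseSet_mem_nhds (F := 𝔼) (V := TangentSpace (𝓡 n)) x, hc] with y hy hcy
  rw [YMForms.hodge, hodgeStar_eq h (tangentBasis y) (coordBasis x hy), hodgeStar_apply, smul_eq_mul]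
  congr 1
  refine Finset.sum_congr rfl fun i _ => ?_
  rw [volumeForm_eq_smul_det, AlternatingMap.smul_apply, hcy hy, ← coordGramDet_eq g x hy,
    ← hfe i y hy, smul_eq_mul, smul_eq_mul]
  congr 2
  · refine congrArg _ (funext fun k => ?_)
    simp only [Y, coordBasis_apply]
  · funext a
    exact (coordDualFrame_eq g x hy (i a)).symm

end MetricSmoothness

/-! ### Curvature as a commutator of covariant derivatives -/

section CurvatureLocal

open Module

variable {n : ℕ} {M : Type*} [TopologicalSpace M]
  [ChartedSpace (EuclideanSpace ℝ (Fin n)) M] [IsManifold (𝓡 n) ∞ M]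
  {F : Type*} [NormedAddCommGroup F] [NormedSpace ℝ F]
  {V : M → Type*} [TopologicalSpace (TotalSpace F V)]
  [∀ x, AddCommGroup (V x)] [∀ x, Module ℝ (V x)] [∀ x, TopologicalSpace (V x)]
  [∀ x, IsTopologicalAddGroup (V x)] [∀ x, ContinuousSMul ℝ (V x)]
  [FiberBundle F V] [VectorBundle ℝ F V] [ContMDiffVectorBundle ∞ F V (𝓡 n)]

local notation "𝔼" => EuclideanSpace ℝ (Fin n)

variable (n F) in
/-- The section `σ` is smooth in a neighbourhood of `x`. -/
def SmoothNear (σ : Π y : M, V y) (x : M) : Prop :=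
  ∀ᶠ y in 𝓝 x, ContMDiffAt (𝓡 n) ((𝓡 n).prod 𝓘(ℝ, F)) ∞
    (fun y => (⟨y, σ y⟩ : TotalSpace F V)) y

/-- The vector field `X` is smooth in a neighbourhood of `x`. -/
def SmoothFieldNear (X : Π y : M, TangentSpace (𝓡 n) y) (x : M) : Prop :=
  ∀ᶠ y in 𝓝 x, SmoothFieldAt X y

theorem SmoothNear.mdifferentiableAt {σ : Π y : M, V y} {x : M} (hσ : SmoothNear n F σ x) :
    MDifferentiableAt (𝓡 n) ((𝓡 n).prod 𝓘(ℝ, F)) (fun y => (⟨y, σ y⟩ : TotalSpace F V)) x :=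
  hσ.self_of_nhds.mdifferentiableAt (by simp)

theorem SmoothFieldNear.mdifferentiableAt {X : Π y : M, TangentSpace (𝓡 n) y} {x : M}
    (hX : SmoothFieldNear X x) : MDifferentiableAt (𝓡 n) ((𝓡 n).prod 𝓘(ℝ, 𝔼))
      (fun y => (⟨y, X y⟩ : TotalSpace 𝔼 (TangentSpace (𝓡 n) (M := M)))) x :=
  hX.self_of_nhds.mdifferentiableAt (by simp)

theorem SmoothNear.add {σ σ' : Π y : M, V y} {x : M} (hσ : SmoothNear n F σ x)
    (hσ' : SmoothNear n F σ' x) : SmoothNear n F (σ + σ') x := by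
  filter_upwards [hσ, hσ'] with y h h' using h.add_section h'

theorem SmoothNear.smul {f : M → ℝ} {σ : Π y : M, V y} {x : M}
    (hf : ∀ᶠ y in 𝓝 x, ContMDiffAt (𝓡 n) 𝓘(ℝ) ∞ f y) (hσ : SmoothNear n F σ x) :
    SmoothNear n F (f • σ) x := by
  filter_upwards [hf, hσ] with y h h' using h.smul_section h'

theorem SmoothNear.exists_contMDiffOn {σ : Π y : M, V y} {x : M} (hσ : SmoothNear n F σ x) :
    ∃ s ∈ 𝓝 x, ContMDiffOn (𝓡 n) ((𝓡 n).prod 𝓘(ℝ, F)) ∞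
      (fun y => (⟨y, σ y⟩ : TotalSpace F V)) s :=
  ⟨_, hσ, fun _ hy => ContMDiffAt.contMDiffWithinAt hy⟩

theorem smoothNear_constExt {x y : M} (hy : y ∈ (trivializationAt F V x).baseSet) (w : V x) :
    SmoothNear n F (constExt F w) y := by
  filter_upwards [(trivializationAt F V x).open_baseSet.mem_nhds hy] with z hz
  exact contMDiffAt_constExt hz w

theorem smoothFieldNear_coordField {x y : M} (hy : y ∈ (chartAt 𝔼 x).source) (v : 𝔼) :
    SmoothFieldNear (coordField x v) y := by
  refine smoothNear_constExt (F := 𝔼) (V := TangentSpace (𝓡 n)) ?_ _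
  rwa [TangentBundle.trivializationAt_baseSet]

/-- The covariant derivative `∇_X σ` of a section along a vector field. -/
noncomputable def nabla (cov : CovariantDerivative (𝓡 n) F V) (X : Π y : M, TangentSpace (𝓡 n) y)
    (σ : Π y : M, V y) : Π y : M, V y := fun y => cov σ y (X y)

variable [T2Space M] (cov : CovariantDerivative (𝓡 n) F V)
  (hcov : CovariantDerivative.ContMDiffCovariantDerivative cov ∞)

include hcov in
theorem contMDiffAt_nabla {x : M} {X : Π y : M, TangentSpace (𝓡 n) y} {σ : Π y : M, V y}
    (hX : SmoothFieldAt X x) (hσ : SmoothNear n F σ x) :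
    ContMDiffAt (𝓡 n) ((𝓡 n).prod 𝓘(ℝ, F)) ∞
      (fun y => (⟨y, nabla cov X σ y⟩ : TotalSpace F V)) x := by
  have : ContMDiffVectorBundle 1 F V (𝓡 n) := ContMDiffVectorBundle.of_le (n := ∞) (by simp)
  obtain ⟨s, hs, hσ⟩ := hσ.exists_contMDiffOn
  obtain ⟨u, hus, huo, hxu⟩ := mem_nhds_iff.1 hs
  -- A bump function makes `σ` globally smooth without changing it near `x`.
  obtain ⟨f, hf, -⟩ := (SmoothBumpFunction.nhds_basis_support (I := 𝓡 n)
    (huo.mem_nhds hxu)).mem_iff.1 (huo.mem_nhds hxu)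
  have h1 := ContMDiffOn.smul_section_of_tsupport (u := u) (f.contMDiff.contMDiffOn) huo hf
    (hσ.mono hus)
  have h2 := hcov.contMDiff.contMDiff (h1.contMDiffOn)
  have h3 := (h2.contMDiffAt Filter.univ_mem).clm_bundle_apply hX
  refine h3.congr_of_eventuallyEq ?_
  filter_upwards [f.eventuallyEq_one.eventuallyEq_nhds, huo.mem_nhds hxu] with y hy hyu
  have hσy := ((hσ.mono hus).contMDiffAt (huo.mem_nhds hyu)).mdifferentiableAt (by simp)
  have := cov.isCovariantDerivativeOnUniv.congr_of_eventuallyEq (σ := σ) (σ' := ⇑f • σ)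
    hσy ((h1 y).mdifferentiableAt (by simp)) Filter.univ_mem ?_
  · rw [nabla, this]
  · filter_upwards [hy] with z hz
    simp [hz]

include hcov in
theorem SmoothNear.nabla {x : M} {X : Π y : M, TangentSpace (𝓡 n) y} {σ : Π y : M, V y}
    (hX : SmoothFieldNear X x) (hσ : SmoothNear n F σ x) : SmoothNear n F (nabla cov X σ) x := by
  filter_upwards [hX, eventually_eventually_nhds.2 hσ] with y hXy hσy
  exact contMDiffAt_nabla cov hcov hXy hσy

theorem nabla_congr {x : M} (X : Π y : M, TangentSpace (𝓡 n) y) {σ σ' : Π y : M, V y}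
    (hσ : SmoothNear n F σ x) (hσ' : SmoothNear n F σ' x) (h : ∀ᶠ y in 𝓝 x, σ y = σ' y) :
    nabla cov X σ x = nabla cov X σ' x := by
  have : ContMDiffVectorBundle 1 F V (𝓡 n) := ContMDiffVectorBundle.of_le (n := ∞) (by simp)
  exact congrArg (fun L => L (X x)) (cov.isCovariantDerivativeOnUniv.congr_of_eventuallyEq
    hσ.mdifferentiableAt hσ'.mdifferentiableAt Filter.univ_mem h)

theorem nabla_add {x : M} (X : Π y : M, TangentSpace (𝓡 n) y) {σ σ' : Π y : M, V y}
    (hσ : SmoothNear n F σ x) (hσ' : SmoothNear n F σ' x) :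
    nabla cov X (σ + σ') x = nabla cov X σ x + nabla cov X σ' x :=
  congrArg (fun L => L (X x)) (cov.isCovariantDerivativeOnUniv.add
    hσ.mdifferentiableAt hσ'.mdifferentiableAt)

theorem nabla_smul {x : M} (X : Π y : M, TangentSpace (𝓡 n) y) {f : M → ℝ} {σ : Π y : M, V y}
    (hf : MDifferentiableAt (𝓡 n) 𝓘(ℝ) f x) (hσ : SmoothNear n F σ x) :
    nabla cov X (f • σ) x = f x • nabla cov X σ x + mvfderiv (𝓡 n) f x (X x) • σ x :=
  congrArg (fun L => L (X x)) (cov.isCovariantDerivativeOnUniv.leibniz hσ.mdifferentiableAt hf)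

/-- The commutator `∇_X ∇_Y σ - ∇_Y ∇_X σ`. -/
noncomputable def nablaComm (X Y : Π y : M, TangentSpace (𝓡 n) y) (σ : Π y : M, V y) :
    Π y : M, V y :=
  fun y => nabla cov X (nabla cov Y σ) y - nabla cov Y (nabla cov X σ) y

section Commutator

variable {x : M} {X Y : Π y : M, TangentSpace (𝓡 n) y} (hX : SmoothFieldNear X x)
  (hY : SmoothFieldNear Y x)

include hcov hX in
theorem nabla_nabla_congr {σ σ' : Π y : M, V y} (hσ : SmoothNear n F σ x)
    (hσ' : SmoothNear n F σ' x) (h : ∀ᶠ y in 𝓝 x, σ y = σ' y) (Y : Π y : M, TangentSpace (𝓡 n) y) :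
    nabla cov Y (nabla cov X σ) x = nabla cov Y (nabla cov X σ') x := by
  refine nabla_congr cov Y (hσ.nabla cov hcov hX) (hσ'.nabla cov hcov hX) ?_
  filter_upwards [eventually_eventually_nhds.2 hσ, eventually_eventually_nhds.2 hσ',
    eventually_eventually_nhds.2 h] with y h1 h2 h3
  exact nabla_congr cov X h1 h2 h3

include hcov hX hY in
theorem nablaComm_congr {σ σ' : Π y : M, V y} (hσ : SmoothNear n F σ x)
    (hσ' : SmoothNear n F σ' x) (h : ∀ᶠ y in 𝓝 x, σ y = σ' y) :
    nablaComm cov X Y σ x = nablaComm cov X Y σ' x := by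
  rw [nablaComm, nablaComm, nabla_nabla_congr cov hcov hY hσ hσ' h,
    nabla_nabla_congr cov hcov hX hσ hσ' h]

include hcov hX in
theorem nabla_nabla_add {σ σ' : Π y : M, V y} (hσ : SmoothNear n F σ x)
    (hσ' : SmoothNear n F σ' x) (Y : Π y : M, TangentSpace (𝓡 n) y) :
    nabla cov Y (nabla cov X (σ + σ')) x =
      nabla cov Y (nabla cov X σ) x + nabla cov Y (nabla cov X σ') x := by
  rw [← nabla_add cov Y (hσ.nabla cov hcov hX) (hσ'.nabla cov hcov hX)]
  refine nabla_congr cov Y ((hσ.add hσ').nabla cov hcov hX)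
    ((hσ.nabla cov hcov hX).add (hσ'.nabla cov hcov hX)) ?_
  filter_upwards [eventually_eventually_nhds.2 hσ, eventually_eventually_nhds.2 hσ'] with y h1 h2
  exact nabla_add cov X h1 h2

include hcov hX hY in
theorem nablaComm_add {σ σ' : Π y : M, V y} (hσ : SmoothNear n F σ x)
    (hσ' : SmoothNear n F σ' x) :
    nablaComm cov X Y (σ + σ') x = nablaComm cov X Y σ x + nablaComm cov X Y σ' x := by
  simp only [nablaComm, nabla_nabla_add cov hcov hY hσ hσ', nabla_nabla_add cov hcov hX hσ hσ']
  abel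

include hcov hX in
theorem nabla_nabla_smul {f : M → ℝ} {σ : Π y : M, V y}
    (hf : ∀ᶠ y in 𝓝 x, ContMDiffAt (𝓡 n) 𝓘(ℝ) ∞ f y)
    (hXf : ∀ᶠ y in 𝓝 x, ContMDiffAt (𝓡 n) 𝓘(ℝ) ∞ (fun y => mvfderiv (𝓡 n) f y (X y)) y)
    (hσ : SmoothNear n F σ x) (Y : Π y : M, TangentSpace (𝓡 n) y) :
    nabla cov Y (nabla cov X (f • σ)) x =
      f x • nabla cov Y (nabla cov X σ) x + mvfderiv (𝓡 n) f x (Y x) • nabla cov X σ x +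
      (mvfderiv (𝓡 n) f x (X x) • nabla cov Y σ x +
        mvfderiv (𝓡 n) (fun y => mvfderiv (𝓡 n) f y (X y)) x (Y x) • σ x) := by
  have hXσ := hσ.nabla cov hcov hX
  rw [← nabla_smul cov Y (hf.self_of_nhds.mdifferentiableAt (by simp)) hXσ,
    ← nabla_smul cov Y (hXf.self_of_nhds.mdifferentiableAt (by simp)) hσ,
    ← nabla_add cov Y (hXσ.smul hf) (hσ.smul hXf)]
  refine nabla_congr cov Y ((hσ.smul hf).nabla cov hcov hX)
    ((hXσ.smul hf).add (hσ.smul hXf)) ?_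
  filter_upwards [hf, eventually_eventually_nhds.2 hσ] with y h1 h2
  exact nabla_smul cov X (h1.mdifferentiableAt (by simp)) h2

end Commutator

section CoordinateCommutator

include hcov in
/-- Linearity over functions: the terms with a derivative of `f` cancel, since second derivatives
along coordinate fields are symmetric. -/
theorem nablaComm_coordField_smul {x z : M} (hz : z ∈ (chartAt 𝔼 x).source)
    (a b : 𝔼) {f : M → ℝ} {σ : Π y : M, V y}
    (hf : ∀ᶠ y in 𝓝 z, ContMDiffAt (𝓡 n) 𝓘(ℝ) ∞ f y) (hσ : SmoothNear n F σ z) :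
    nablaComm cov (coordField x a) (coordField x b) (f • σ) z =
      f z • nablaComm cov (coordField x a) (coordField x b) σ z := by
  have hd : ∀ v : 𝔼, ∀ᶠ y in 𝓝 z, ContMDiffAt (𝓡 n) 𝓘(ℝ) ∞
      (fun y => mvfderiv (𝓡 n) f y (coordField x v y)) y := by
    intro v
    filter_upwards [hf, (chartAt 𝔼 x).open_source.mem_nhds hz] with y h1 h2
    exact contMDiffAt_mvfderiv_constExt h2 v h1
  rw [nablaComm, nablaComm,
    nabla_nabla_smul cov hcov (smoothFieldNear_coordField hz b) hf (hd b) hσ,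
    nabla_nabla_smul cov hcov (smoothFieldNear_coordField hz a) hf (hd a) hσ,
    mvfderiv_mvfderiv_constExt_comm hz b a hf.self_of_nhds, smul_sub]
  abel

include hcov in
theorem nablaComm_coordField_sum {ι : Type*} {x z : M} (hz : z ∈ (chartAt 𝔼 x).source)
    (a b : 𝔼) (s : Finset ι) {f : ι → M → ℝ}
    {σ : ι → Π y : M, V y}
    (hf : ∀ i, ∀ᶠ y in 𝓝 z, ContMDiffAt (𝓡 n) 𝓘(ℝ) ∞ (f i) y)
    (hσ : ∀ i, SmoothNear n F (σ i) z) :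
    SmoothNear n F (∑ i ∈ s, f i • σ i) z ∧
    nablaComm cov (coordField x a) (coordField x b) (∑ i ∈ s, f i • σ i) z =
      ∑ i ∈ s, f i z • nablaComm cov (coordField x a) (coordField x b) (σ i) z := by
  classical
  induction s using Finset.induction_on with
  | empty =>
    have h0 : ∀ X, nabla cov X 0 = 0 := by
      intro X
      funext y
      simp [nabla]
    refine ⟨?_, ?_⟩
    · exact Filter.Eventually.of_forall fun y => contMDiff_zeroSection ℝ V y
    · simp [nablaComm, h0]
  | insert i s his ih =>
    rw [Finset.sum_insert his, Finset.sum_insert his]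
    refine ⟨((hσ i).smul (hf i)).add ih.1, ?_⟩
    rw [nablaComm_add cov hcov (smoothFieldNear_coordField hz a) (smoothFieldNear_coordField hz b)
      ((hσ i).smul (hf i)) ih.1, ih.2, nablaComm_coordField_smul cov hcov hz a b (hf i) (hσ i)]

include hcov in
/-- The commutator along coordinate fields depends on the section only through its value, by
expansion in a local frame. -/
theorem nablaComm_coordField_pointwise [FiniteDimensional ℝ F] {x z : M}
    (hz : z ∈ (chartAt 𝔼 x).source) (a b : 𝔼) {σ σ' : Π y : M, V y}
    (hσ : SmoothNear n F σ z) (hσ' : SmoothNear n F σ' z) (h : σ z = σ' z) :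
    nablaComm cov (coordField x a) (coordField x b) σ z =
      nablaComm cov (coordField x a) (coordField x b) σ' z := by
  have : ContMDiffVectorBundle 1 F V (𝓡 n) := ContMDiffVectorBundle.of_le (n := ∞) (by simp)
  let t := trivializationAt F V z
  have hzt : z ∈ t.baseSet := mem_baseSet_trivializationAt' z
  let B := Basis.ofVectorSpace ℝ F
  have hs : ∀ i, SmoothNear n F (t.localFrame B i) z := by
    intro i
    filter_upwards [t.open_baseSet.mem_nhds hzt] with y hy
    exact contMDiffAt_localFrame_of_mem ∞ t B i hy
  have key : ∀ {σ : Π y : M, V y}, SmoothNear n F σ z →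
      nablaComm cov (coordField x a) (coordField x b) σ z =
        ∑ i, t.localFrameCoeff (𝓡 n) B i z (σ z) •
          nablaComm cov (coordField x a) (coordField x b) (t.localFrame B i) z := by
    intro σ hσ
    have hc : ∀ i, ∀ᶠ y in 𝓝 z, ContMDiffAt (𝓡 n) 𝓘(ℝ) ∞
        (fun y => t.localFrameCoeff (𝓡 n) B i y (σ y)) y := by
      intro i
      filter_upwards [t.open_baseSet.mem_nhds hzt, hσ] with y hy h1
      exact contMDiffAt_localFrameCoeff B hy h1 i
    obtain ⟨h1, h2⟩ := nablaComm_coordField_sum cov hcov hz a b Finset.univ hc hs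
    rw [← h2]
    refine nablaComm_congr cov hcov (smoothFieldNear_coordField hz a)
      (smoothFieldNear_coordField hz b) hσ h1 ?_
    filter_upwards [t.eventually_eq_localFrame_sum_coeff_smul (I := 𝓡 n) B hzt (s := σ)] with y hy
    rw [hy]
    simp
  rw [key hσ, key hσ', h]

end CoordinateCommutator

section Tensoriality

variable {x : M} {σ : Π y : M, V y} (hσ : SmoothNear n F σ x)

theorem curvatureFun_swap (X Y : Π y : M, TangentSpace (𝓡 n) y) (σ : Π y : M, V y) (x : M) :
    curvatureFun cov X Y σ x = - curvatureFun cov Y X σ x := by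
  simp only [curvatureFun]
  rw [mlieBracket_swap_apply, map_neg]
  abel

include hcov hσ in
theorem tensorialAt_curvatureFun_left {Y : Π y : M, TangentSpace (𝓡 n) y} :
    TensorialAt (𝓡 n) 𝔼 (fun X => curvatureFun cov X Y σ x) x := by
  obtain ⟨s, hs, hσs⟩ := hσ.exists_contMDiffOn
  refine ⟨fun {f X} hf hX => ?_, fun {X X'} hX hX' => ?_⟩
  · have h1 := cov.isCovariantDerivativeOnUniv.leibniz (mdifferentiableAt_cov cov hcov hX hs hσs) hf
    have e : (fun y => cov σ y ((f • X) y)) = f • fun y => cov σ y (X y) := by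
      funext y
      simp
    simp only [curvatureFun]
    rw [e, h1, mlieBracket_smul_left hf hX]
    simp only [Pi.smul_apply', map_smul, map_add, _root_.add_apply, _root_.smul_apply,
      ContinuousLinearMap.smulRight_apply, neg_smul, map_neg, smul_sub]
    abel
  · have h1 := cov.isCovariantDerivativeOnUniv.add (mdifferentiableAt_cov cov hcov hX hs hσs)
      (mdifferentiableAt_cov cov hcov hX' hs hσs)
    have e : (fun y => cov σ y ((X + X') y)) =
        (fun y => cov σ y (X y)) + fun y => cov σ y (X' y) := by
      funext y
      simp
    simp only [curvatureFun]
    rw [e, h1, mlieBracket_add_left hX hX']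
    simp only [Pi.add_apply, map_add, _root_.add_apply]
    abel

include hcov hσ in
/-- `curvatureFun` depends on the vector fields only through their values. -/
theorem curvatureFun_pointwise {X X' Y Y' : Π y : M, TangentSpace (𝓡 n) y}
    (hX : SmoothFieldNear X x) (hX' : SmoothFieldNear X' x) (hY : SmoothFieldNear Y x)
    (hY' : SmoothFieldNear Y' x) (hXX' : X x = X' x) (hYY' : Y x = Y' x) :
    curvatureFun cov X Y σ x = curvatureFun cov X' Y' σ x := by
  have : ContMDiffVectorBundle 1 𝔼 (TangentSpace (𝓡 n) (M := M)) (𝓡 n) :=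
    ContMDiffVectorBundle.of_le (n := ∞) (by simp)
  rw [(tensorialAt_curvatureFun_left cov hcov hσ).pointwise hX.mdifferentiableAt
    hX'.mdifferentiableAt hXX', curvatureFun_swap,
    (tensorialAt_curvatureFun_left cov hcov hσ).pointwise hY.mdifferentiableAt
    hY'.mdifferentiableAt hYY', ← curvatureFun_swap]

end Tensoriality

/-- Curvature along coordinate fields is the commutator of covariant derivatives. Here `z` is any
point of the chart domain at `x`, whereas the curvature at `z` is defined by the chart and the
trivialization at `z`. -/
theorem curvature_coordField [FiniteDimensional ℝ F] {x z : M} (hz : z ∈ (chartAt 𝔼 x).source)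
    (u : Fin 2 → 𝔼) {σ : Π y : M, V y} (hσ : SmoothNear n F σ z) :
    curvature cov hcov z (fun k => coordField x (u k) z) (σ z) =
      nablaComm cov (coordField x (u 0)) (coordField x (u 1)) σ z := by
  have hzz := mem_chart_source 𝔼 z
  have hτ : SmoothNear n F (constExt F (σ z)) z :=
    smoothNear_constExt (mem_baseSet_trivializationAt' z) _
  have h1 : curvature cov hcov z (fun k => coordField x (u k) z) (σ z) =
      curvatureFun cov (coordField x (u 0)) (coordField x (u 1)) (constExt F (σ z)) z :=
    curvatureFun_pointwise cov hcov hτ (smoothFieldNear_coordField hzz _)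
      (smoothFieldNear_coordField hz _) (smoothFieldNear_coordField hzz _)
      (smoothFieldNear_coordField hz _) (constExt_self _) (constExt_self _)
  rw [h1, curvatureFun, mlieBracket_constExt hz, map_zero, sub_zero]
  exact nablaComm_coordField_pointwise cov hcov hz _ _ hτ hσ (constExt_self _)

end CurvatureLocal

/-! ### Derivatives of components and the Bianchi identity -/

section Bianchi

open Module

variable {n : ℕ} {M : Type*} [TopologicalSpace M]
  [ChartedSpace (EuclideanSpace ℝ (Fin n)) M] [IsManifold (𝓡 n) ∞ M]

local notation "𝔼" => EuclideanSpace ℝ (Fin n)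

/-- The linear map `v ↦ coordField x v y`. Composition with it gives the components at `y` of a form
in the chart at `x`. -/
noncomputable def coordLin (x y : M) : 𝔼 →ₗ[ℝ] TangentSpace (𝓡 n) y where
  toFun v := coordField x v y
  map_add' v w := congrFun (constExt_add (F := 𝔼) (V := TangentSpace (𝓡 n)) (x := x) v w) y
  map_smul' c v := congrFun (constExt_smul (F := 𝔼) (V := TangentSpace (𝓡 n)) (x := x) c v) y

theorem coordField_self (x : M) (v : 𝔼) : coordField x v x = v :=
  constExt_self (F := 𝔼) (V := TangentSpace (𝓡 n)) (x := x) v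

/-- The derivative at `x` of the components of a form in the chart at `x`: `v u ↦ ∂_v (η (u))`. -/
noncomputable def formDeriv {p : ℕ} (η : FormField n M p) (hη : IsSmoothForm η) (x : M) :
    𝔼 →ₗ[ℝ] 𝔼 [⋀^Fin p]→ₗ[ℝ] ℝ :=
  have hd : ∀ u : Fin p → 𝔼, MDifferentiableAt (𝓡 n) 𝓘(ℝ)
      (fun y => (η y).compLinearMap (coordLin x y) u) x := fun u =>
    (hη x _ fun k => (smoothFieldNear_coordField (mem_chart_source 𝔼 x) (u k)).self_of_nhds
      ).mdifferentiableAt (by simp)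
  { toFun := fun v =>
      { toFun := fun u => mvfderiv (𝓡 n) (fun y => (η y).compLinearMap (coordLin x y) u) x
          (coordLin x x v)
        map_update_add' := by
          intro inst u i a b
          have e := mvfderiv_add (hd (Function.update u i a)) (hd (Function.update u i b))
          simp only [AlternatingMap.map_update_add]
          exact congrArg (fun L => L (coordLin x x v)) e
        map_update_smul' := by
          intro inst u i c a
          have e := mvfderiv_smul (mdifferentiableAt_const (c := c)) (hd (Function.update u i a))
          rw [mvfderiv_const] at e
          simp only [AlternatingMap.map_update_smul]
          refine (congrArg (fun L => L (coordLin x x v)) e).trans ?_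
          simp
        map_eq_zero_of_eq' := by
          intro u i j hu hij
          have e : (fun y => (η y).compLinearMap (coordLin x y) u) = 0 :=
            funext fun y => AlternatingMap.map_eq_zero_of_eq _ _ hu hij
          rw [e, mvfderiv_zero]
          rfl }
    map_add' := fun v v' => by
      ext u
      simp
    map_smul' := fun c v => by
      ext u
      simp }

theorem formDeriv_apply {p : ℕ} (η : FormField n M p) (hη : IsSmoothForm η) (x : M) (v : 𝔼)
    (u : Fin p → 𝔼) : formDeriv η hη x v u =
      mvfderiv (𝓡 n) (fun y => η y fun k => coordField x (u k) y) x (coordField x v x) := rfl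

/-- The exterior derivative is the alternatization of the derivative of the components. -/
theorem alternatizeUncurryFin_formDeriv {p : ℕ} (η : FormField n M p) (hη : IsSmoothForm η)
    (x : M) (v : Fin (p + 1) → 𝔼) :
    AlternatingMap.alternatizeUncurryFin (formDeriv η hη x) v = extDerivForm η x v := by
  rw [extDerivForm_apply η x fun u => (hη x _ fun k =>
    (smoothFieldNear_coordField (mem_chart_source 𝔼 x) (u k)).self_of_nhds).mdifferentiableAt
      (by simp), AlternatingMap.alternatizeUncurryFin_apply]
  refine Finset.sum_congr rfl fun i _ => ?_
  rw [formDeriv_apply, zsmul_eq_mul]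
  push_cast
  rfl

variable {F : Type*} [NormedAddCommGroup F] [NormedSpace ℝ F] [FiniteDimensional ℝ F]
  {V : M → Type*} [TopologicalSpace (TotalSpace F V)]
  [∀ x, AddCommGroup (V x)] [∀ x, Module ℝ (V x)] [∀ x, TopologicalSpace (V x)]
  [∀ x, IsTopologicalAddGroup (V x)] [∀ x, ContinuousSMul ℝ (V x)]
  [FiberBundle F V] [VectorBundle ℝ F V] [ContMDiffVectorBundle ∞ F V (𝓡 n)]
  [T2Space M] (cov : CovariantDerivative (𝓡 n) F V)
  (hcov : CovariantDerivative.ContMDiffCovariantDerivative cov ∞)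

theorem SmoothNear.sub {σ σ' : Π y : M, V y} {x : M} (hσ : SmoothNear n F σ x)
    (hσ' : SmoothNear n F σ' x) : SmoothNear n F (σ - σ') x := by
  filter_upwards [hσ, hσ'] with y h h' using h.sub_section h'

theorem SmoothNear.congr {σ σ' : Π y : M, V y} {x : M} (hσ : SmoothNear n F σ x)
    (h : ∀ᶠ y in 𝓝 x, σ' y = σ y) : SmoothNear n F σ' x := by
  filter_upwards [hσ, eventually_eventually_nhds.2 h] with y h1 h2
  refine h1.congr_of_eventuallyEq ?_
  filter_upwards [h2] with z hz
  rw [hz]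

theorem nabla_sub {x : M} (X : Π y : M, TangentSpace (𝓡 n) y) {σ σ' : Π y : M, V y}
    (hσ : SmoothNear n F σ x) (hσ' : SmoothNear n F σ' x) :
    nabla cov X (σ - σ') x = nabla cov X σ x - nabla cov X σ' x := by
  have := nabla_add cov X (hσ.sub hσ') hσ'
  rw [sub_add_cancel] at this
  rw [this, add_sub_cancel_right]

theorem nabla_sum {ι : Type*} (s : Finset ι) {x : M} (X : Π y : M, TangentSpace (𝓡 n) y)
    {f : ι → M → ℝ} {σ : ι → Π y : M, V y}
    (hf : ∀ i, ∀ᶠ y in 𝓝 x, ContMDiffAt (𝓡 n) 𝓘(ℝ) ∞ (f i) y)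
    (hσ : ∀ i, SmoothNear n F (σ i) x) :
    SmoothNear n F (∑ i ∈ s, f i • σ i) x ∧ nabla cov X (∑ i ∈ s, f i • σ i) x =
      ∑ i ∈ s, (f i x • nabla cov X (σ i) x + mvfderiv (𝓡 n) (f i) x (X x) • σ i x) := by
  classical
  induction s using Finset.induction_on with
  | empty =>
    refine ⟨Filter.Eventually.of_forall fun y => contMDiff_zeroSection ℝ V y, ?_⟩
    simp [nabla]
  | insert i s his ih =>
    rw [Finset.sum_insert his, Finset.sum_insert his]
    refine ⟨((hσ i).smul (hf i)).add ih.1, ?_⟩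
    rw [nabla_add cov X ((hσ i).smul (hf i)) ih.1, ih.2,
      nabla_smul cov X ((hf i).self_of_nhds.mdifferentiableAt (by simp)) (hσ i)]

/-- The section `F(∂_u₀, ∂_u₁) σ`, where the `∂_u` are coordinate fields of the chart at `x` and `σ`
is the extension of `w` that is constant in the trivialization at `x`. -/
noncomputable def curvatureSection (x : M) (u : Fin 2 → 𝔼) (w : V x) : Π y : M, V y := fun y =>
  (curvature cov hcov y).compLinearMap (coordLin x y) u (constExt F w y)

theorem curvatureSection_eventuallyEq (x : M) (u : Fin 2 → 𝔼) (w : V x) :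
    ∀ᶠ y in 𝓝 x, curvatureSection cov hcov x u w y =
      nablaComm cov (coordField x (u 0)) (coordField x (u 1)) (constExt F w) y := by
  filter_upwards [(chartAt 𝔼 x).open_source.mem_nhds (mem_chart_source 𝔼 x),
    baseSet_mem_nhds (F := F) (V := V) x] with y hy hyV
  exact curvature_coordField cov hcov hy u (smoothNear_constExt hyV w)

include hcov in
theorem SmoothNear.nablaComm {x : M} {X Y : Π y : M, TangentSpace (𝓡 n) y} {σ : Π y : M, V y}
    (hX : SmoothFieldNear X x) (hY : SmoothFieldNear Y x) (hσ : SmoothNear n F σ x) :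
    SmoothNear n F (nablaComm cov X Y σ) x :=
  ((hσ.nabla cov hcov hY).nabla cov hcov hX).sub ((hσ.nabla cov hcov hX).nabla cov hcov hY)

theorem smoothNear_curvatureSection (x : M) (u : Fin 2 → 𝔼) (w : V x) :
    SmoothNear n F (curvatureSection cov hcov x u w) x :=
  (SmoothNear.nablaComm cov hcov (smoothFieldNear_coordField (mem_chart_source 𝔼 x) _)
    (smoothFieldNear_coordField (mem_chart_source 𝔼 x) _)
    (smoothNear_constExt (mem_baseSet_trivializationAt' x) w)).congr
      (curvatureSection_eventuallyEq cov hcov x u w)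

/-- The covariant derivative at `x` of the components of the curvature in the chart at `x`, applied
to `w`: `v u ↦ ∇_v (F(u) σ) - F(u) ∇_v σ`. -/
noncomputable def curvatureDeriv (x : M) (w : V x) : 𝔼 →ₗ[ℝ] 𝔼 [⋀^Fin 2]→ₗ[ℝ] V x where
  toFun v :=
    { toFun := fun u => nabla cov (coordField x v) (curvatureSection cov hcov x u w) x -
        (curvature cov hcov x).compLinearMap (coordLin x x) u
          (nabla cov (coordField x v) (constExt F w) x)
      map_update_add' := by
        intro inst u i a b
        have e : curvatureSection cov hcov x (Function.update u i (a + b)) w =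
            curvatureSection cov hcov x (Function.update u i a) w +
            curvatureSection cov hcov x (Function.update u i b) w := by
          funext y
          simp only [curvatureSection, AlternatingMap.map_update_add, Pi.add_apply]
          rfl
        rw [e, nabla_add cov _ (smoothNear_curvatureSection cov hcov x _ w)
          (smoothNear_curvatureSection cov hcov x _ w), AlternatingMap.map_update_add,
          LinearMap.add_apply]
        abel
      map_update_smul' := by
        intro inst u i c a
        have e : curvatureSection cov hcov x (Function.update u i (c • a)) w =
            (fun _ : M => c) • curvatureSection cov hcov x (Function.update u i a) w := by
          funext y
          simp only [curvatureSection, AlternatingMap.map_update_smul]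
          rfl
        rw [e, nabla_smul cov _ mdifferentiableAt_const
          (smoothNear_curvatureSection cov hcov x _ w), AlternatingMap.map_update_smul,
          LinearMap.smul_apply, mvfderiv_const]
        simp [smul_sub]
      map_eq_zero_of_eq' := by
        intro u i j hu hij
        have e : curvatureSection cov hcov x u w = 0 := by
          funext y
          rw [curvatureSection, AlternatingMap.map_eq_zero_of_eq _ _ hu hij]
          rfl
        rw [e, AlternatingMap.map_eq_zero_of_eq _ _ hu hij]
        simp [nabla] }
  map_add' v v' := by
    ext u
    have e : coordField x (v + v') x = coordField x v x + coordField x v' x :=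
      map_add (coordLin x x) v v'
    simp only [nabla, AlternatingMap.coe_mk, MultilinearMap.coe_mk, AlternatingMap.add_apply, e,
      map_add]
    abel
  map_smul' c v := by
    ext u
    have e : coordField x (c • v) x = c • coordField x v x := map_smul (coordLin x x) c v
    simp only [nabla, AlternatingMap.coe_mk, MultilinearMap.coe_mk, AlternatingMap.smul_apply, e,
      map_smul, smul_sub, RingHom.id_apply]

theorem curvatureDeriv_apply (x : M) (w : V x) (v : 𝔼) (u : Fin 2 → 𝔼) :
    curvatureDeriv cov hcov x w v u =
      nabla cov (coordField x v) (curvatureSection cov hcov x u w) x -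
        (curvature cov hcov x).compLinearMap (coordLin x x) u
          (nabla cov (coordField x v) (constExt F w) x) := rfl

/-- Near `x` both terms of `curvatureDeriv` are commutators of covariant derivatives along coordinate
fields. -/
theorem curvatureDeriv_eq (x : M) (w : V x) (v : 𝔼) (u : Fin 2 → 𝔼) :
    curvatureDeriv cov hcov x w v u =
      nabla cov (coordField x v)
        (nablaComm cov (coordField x (u 0)) (coordField x (u 1)) (constExt F w)) x -
      nablaComm cov (coordField x (u 0)) (coordField x (u 1))
        (nabla cov (coordField x v) (constExt F w)) x := by
  have hx := mem_chart_source 𝔼 x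
  have hX := fun v : 𝔼 => smoothFieldNear_coordField (x := x) hx v
  have hσ : SmoothNear n F (constExt F w) x :=
    smoothNear_constExt (mem_baseSet_trivializationAt' x) w
  rw [curvatureDeriv_apply, nabla_congr cov _ (smoothNear_curvatureSection cov hcov x u w)
    (hσ.nablaComm cov hcov (hX _) (hX _)) (curvatureSection_eventuallyEq cov hcov x u w),
    ← curvature_coordField cov hcov hx u (hσ.nabla cov hcov (hX v))]
  rfl

/-- The second Bianchi identity `d^∇ F = 0`, which for commuting fields is the Jacobi identity for
the operators `∇_X`. -/
theorem alternatizeUncurryFin_curvatureDeriv (x : M) (w : V x) :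
    AlternatingMap.alternatizeUncurryFin (curvatureDeriv cov hcov x w) = 0 := by
  ext v
  have hx := mem_chart_source 𝔼 x
  have hX := fun v : 𝔼 => smoothFieldNear_coordField (x := x) hx v
  have hσ : SmoothNear n F (constExt F w) x :=
    smoothNear_constExt (mem_baseSet_trivializationAt' x) w
  have key : ∀ a b c : 𝔼, nabla cov (coordField x a)
      (nablaComm cov (coordField x b) (coordField x c) (constExt F w)) x =
      nabla cov (coordField x a) (nabla cov (coordField x b)
        (nabla cov (coordField x c) (constExt F w))) x -
      nabla cov (coordField x a) (nabla cov (coordField x c)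
        (nabla cov (coordField x b) (constExt F w))) x := fun a b c =>
    nabla_sub cov _ ((hσ.nabla cov hcov (hX c)).nabla cov hcov (hX b))
      ((hσ.nabla cov hcov (hX b)).nabla cov hcov (hX c))
  rw [AlternatingMap.alternatizeUncurryFin_apply, Fin.sum_univ_three]
  simp only [curvatureDeriv_eq, key, Fin.removeNth_apply]
  have h1 : (1 : Fin 3).succAbove 0 = 0 := rfl
  have h2 : (1 : Fin 3).succAbove 1 = 2 := rfl
  have h3 : (2 : Fin 3).succAbove 0 = 0 := rfl
  have h4 : (2 : Fin 3).succAbove 1 = 1 := rfl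
  have h5 : (0 : Fin 3).succAbove 0 = 1 := rfl
  have h6 : (0 : Fin 3).succAbove 1 = 2 := rfl
  rw [h1, h2, h3, h4, h5, h6]
  simp only [nablaComm]
  simp
  abel

end Bianchi

/-! ### Self-dual connections -/

section SelfDual

open Module

variable {m : ℕ} {M : Type*} [TopologicalSpace M]
  [ChartedSpace (EuclideanSpace ℝ (Fin (m + 4))) M] [IsManifold (𝓡 (m + 4)) ∞ M]
  (g : PseudoRiemannianMetric (m + 4) M) (o : ManifoldOrientation (m + 4) M)
  {F : Type*} [NormedAddCommGroup F] [NormedSpace ℝ F] [FiniteDimensional ℝ F]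
  {V : M → Type*} [TopologicalSpace (TotalSpace F V)]
  [∀ x, AddCommGroup (V x)] [∀ x, Module ℝ (V x)] [∀ x, TopologicalSpace (V x)]
  [∀ x, IsTopologicalAddGroup (V x)] [∀ x, ContinuousSMul ℝ (V x)]
  [FiberBundle F V] [VectorBundle ℝ F V] [ContMDiffVectorBundle ∞ F V (𝓡 (m + 4))]
  [T2Space M] (cov : CovariantDerivative (𝓡 (m + 4)) F V)
  (hcov : CovariantDerivative.ContMDiffCovariantDerivative cov ∞)
  (Ω : FormField (m + 4) M 4)

local notation "𝔼" => EuclideanSpace ℝ (Fin (m + 4))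

/-- For a self-dual connection `*F` is locally a constant multiple of `*Ω ∧ F`. -/
theorem eventually_starCurvature_eq {μ : ℝ} (hμ : μ ≠ 0)
    (h : ∀ x : M, opB g o Ω x (curvature cov hcov x) = μ • curvature cov hcov x) (x : M) :
    ∃ c : ℝ, ∀ᶠ y in 𝓝 x, starCurvature g o cov hcov y =
      c • wedge (starFour g o Ω y) (curvature cov hcov y) := by
  have h1 : (m + 2) + 2 = m + 4 := rfl
  have h2 : 2 + (m + 2) = m + 4 := by omega
  refine ⟨μ⁻¹ * (((blockSign h1 h2 : ℤ) : ℝ) * (|gramDet (tangentBasis x) (g.inner x)| *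
    (gramDet (tangentBasis x) (g.inner x))⁻¹)), ?_⟩
  filter_upwards [eventually_gramDet_sign_eq g x] with y hy
  have h3 := hodgeStar_hodgeStar h1 h2 (tangentBasis y) (g.inner y) (g.nondegenerate y) (g.symm y)
    (o.orient y) (wedge (starFour g o Ω y) (curvature cov hcov y))
  have h4 : hodgeStar h1 (tangentBasis y) (g.inner y) (g.nondegenerate y) (o.orient y)
    (wedge (starFour g o Ω y) (curvature cov hcov y)) = μ • curvature cov hcov y := h y
  rw [h4, hodgeStar_smul, hy] at h3
  rw [mul_smul, ← h3, smul_smul, inv_mul_cancel₀ hμ, one_smul]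
  rfl

/-- The Leibniz rule for `∇ (η ∧ F)`, in terms of the components in the chart at `x`. -/
theorem covEnd_starCurvature (hΩ : IsSmoothForm (starFour g o Ω)) {x : M} {c : ℝ}
    (hc : ∀ᶠ y in 𝓝 x, starCurvature g o cov hcov y =
      c • wedge (starFour g o Ω y) (curvature cov hcov y))
    (v : 𝔼) (u : Fin (m + 2) → 𝔼) (w : V x) :
    covEnd cov (fun y => starCurvature g o cov hcov y fun j => coordField x (u j) y) x v w =
      c • (wedge (formDeriv _ hΩ x v) ((LinearMap.applyₗ w).compAlternatingMap
          ((curvature cov hcov x).compLinearMap (coordLin x x))) u +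
        wedge ((starFour g o Ω x).compLinearMap (coordLin x x))
          (curvatureDeriv cov hcov x w v) u) := by
  have hx := mem_chart_source 𝔼 x
  -- Near `x` the section `*F(u) σ` is the combination of the sections `τ ρ` with coefficients
  -- `c * κ ρ * f ρ`.
  let κ : Equiv.Perm (Fin (m + 2)) → ℝ := fun ρ =>
    (((m.factorial : ℝ) * (2 : ℕ).factorial)⁻¹ * ((Equiv.Perm.sign ρ : ℤ) : ℝ))
  let f : Equiv.Perm (Fin (m + 2)) → M → ℝ := fun ρ y =>
    starFour g o Ω y fun i => coordField x (u (ρ (Fin.castAdd 2 i))) y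
  let τ : Equiv.Perm (Fin (m + 2)) → Π y : M, V y := fun ρ =>
    curvatureSection cov hcov x (fun j => u (ρ (Fin.natAdd m j))) w
  have hf : ∀ ρ, ∀ᶠ y in 𝓝 x, ContMDiffAt (𝓡 (m + 4)) 𝓘(ℝ) ∞ (f ρ) y := by
    intro ρ
    filter_upwards [(chartAt 𝔼 x).open_source.mem_nhds hx] with y hy
    exact hΩ y _ fun k => (smoothFieldNear_coordField hy _).self_of_nhds
  have hf' : ∀ ρ, ∀ᶠ y in 𝓝 x, ContMDiffAt (𝓡 (m + 4)) 𝓘(ℝ) ∞ (fun y => (c * κ ρ) * f ρ y) y :=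
    fun ρ => (hf ρ).mono fun y hy => contMDiffAt_const.mul hy
  have hτ : ∀ ρ, SmoothNear (m + 4) F (τ ρ) x := fun ρ =>
    smoothNear_curvatureSection cov hcov x _ w
  obtain ⟨hs, hsum⟩ := nabla_sum cov Finset.univ (coordField x v) hf' hτ
  have hstar : ∀ y, starCurvature g o cov hcov y =
      c • wedge (starFour g o Ω y) (curvature cov hcov y) → ∀ w' : V y,
      starCurvature g o cov hcov y (fun j => coordField x (u j) y) w' =
      ∑ ρ, ((c * κ ρ) * f ρ y) • (curvature cov hcov y).compLinearMap (coordLin x y)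
        (fun j => u (ρ (Fin.natAdd m j))) w' := by
    intro y hy w'
    rw [hy, AlternatingMap.smul_apply, wedge_apply, LinearMap.smul_apply, LinearMap.sum_apply,
      Finset.smul_sum]
    refine Finset.sum_congr rfl fun ρ _ => ?_
    rw [LinearMap.smul_apply, LinearMap.smul_apply, smul_smul, smul_smul, mul_assoc]
    rfl
  have hev : ∀ᶠ y in 𝓝 x, starCurvature g o cov hcov y (fun j => coordField x (u j) y)
      (constExt F w y) = (∑ ρ, (fun y => (c * κ ρ) * f ρ y) • τ ρ) y := by
    filter_upwards [hc] with y hy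
    rw [hstar y hy, Finset.sum_apply]
    rfl
  have h1 : cov (fun y => starCurvature g o cov hcov y (fun j => coordField x (u j) y)
      (constExt F w y)) x v = nabla cov (coordField x v) (fun y => starCurvature g o cov hcov y
        (fun j => coordField x (u j) y) (constExt F w y)) x := by
    rw [nabla, coordField_self]
  have h2 : cov (constExt F w) x v = nabla cov (coordField x v) (constExt F w) x := by
    rw [nabla, coordField_self]
  have h5 := (h1.trans (nabla_congr cov _ (hs.congr hev) hs hev)).trans hsum
  have h6 := (congrArg (starCurvature g o cov hcov x fun j => coordField x (u j) x) h2).trans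
    (hstar x hc.self_of_nhds _)
  refine (congrArg₂ (· - ·) h5 h6).trans ?_
  rw [wedge_apply, wedge_apply, ← Finset.sum_add_distrib, ← Finset.sum_sub_distrib, Finset.smul_sum]
  refine Finset.sum_congr rfl fun ρ _ => ?_
  have h3 : mvfderiv (𝓡 (m + 4)) (fun y => (c * κ ρ) * f ρ y) x (coordField x v x) =
      (c * κ ρ) * mvfderiv (𝓡 (m + 4)) (f ρ) x (coordField x v x) := by
    have := mvfderiv_mul (mdifferentiableAt_const (c := c * κ ρ))
      ((hf ρ).self_of_nhds.mdifferentiableAt (by simp))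
    rw [mvfderiv_const] at this
    refine (congrArg (fun L => L (coordField x v x)) this).trans ?_
    simp
  have h4 : τ ρ x = (LinearMap.applyₗ w).compAlternatingMap
      ((curvature cov hcov x).compLinearMap (coordLin x x)) fun j => u (ρ (Fin.natAdd m j)) := by
    simp only [τ, curvatureSection, constExt_self]
    rfl
  rw [h3, curvatureDeriv_apply, formDeriv_apply, h4]
  change _ = c • (κ ρ • mvfderiv (𝓡 (m + 4)) (f ρ) x (coordField x v x) • _ + κ ρ • f ρ x • _)
  simp only [smul_add, smul_sub, smul_smul, mul_assoc]
  abel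

/-- The Yang-Mills equation holds because `d^∇ *F` is a multiple of `(d *Ω) ∧ F ± *Ω ∧ d^∇ F`. -/
theorem isYangMills_of_selfDual (hΩ : IsSmoothForm Ω) {μ : ℝ} (hμ : μ ≠ 0)
    (hsd : IsSelfDual g o Ω μ cov hcov) : IsYangMills g o cov hcov := by
  intro x (v : Fin (m + 2 + 1) → 𝔼) w
  have hη : IsSmoothForm (starFour g o Ω) := hΩ.hodge g o (Nat.add_comm 4 m)
  obtain ⟨c, hc⟩ := eventually_starCurvature_eq g o cov hcov Ω hμ hsd.1 x
  set β : 𝔼 [⋀^Fin 2]→ₗ[ℝ] V x := (LinearMap.applyₗ w).compAlternatingMap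
    ((curvature cov hcov x).compLinearMap (coordLin x x)) with hβ
  set α : 𝔼 [⋀^Fin m]→ₗ[ℝ] ℝ := (starFour g o Ω x).compLinearMap (coordLin x x) with hα
  let W₁ : 𝔼 →ₗ[ℝ] 𝔼 [⋀^Fin (m + 2)]→ₗ[ℝ] V x :=
    { toFun := fun v => wedge (formDeriv _ hη x v) β
      map_add' := fun v v' => by rw [map_add, wedge_add_left]
      map_smul' := fun r v => by rw [map_smul, wedge_smul_left, RingHom.id_apply] }
  let W₂ : 𝔼 →ₗ[ℝ] 𝔼 [⋀^Fin (m + 2)]→ₗ[ℝ] V x :=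
    { toFun := fun v => wedge α (curvatureDeriv cov hcov x w v)
      map_add' := fun v v' => by rw [map_add, wedge_add_right]
      map_smul' := fun r v => by rw [map_smul, wedge_smul_right, RingHom.id_apply] }
  have h1 : AlternatingMap.alternatizeUncurryFin W₁ = 0 := by
    rw [alternatizeUncurryFin_wedge_left (formDeriv _ hη x) β W₁ fun _ => rfl]
    have e1 : AlternatingMap.alternatizeUncurryFin (formDeriv _ hη x) =
        extDerivForm (starFour g o Ω) x :=
      AlternatingMap.ext fun v => alternatizeUncurryFin_formDeriv _ hη x v
    have e2 : (curvature cov hcov x).compLinearMap (coordLin x x) = curvature cov hcov x := by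
      refine AlternatingMap.ext fun v => ?_
      exact congrArg (curvature cov hcov x) (funext fun k => coordField_self x (v k))
    have e3 : wedge (AlternatingMap.alternatizeUncurryFin (formDeriv _ hη x))
        ((curvature cov hcov x).compLinearMap (coordLin x x)) = 0 :=
      (congrArg₂ wedge e1 e2).trans (hsd.2 x)
    rw [hβ, wedge_compAlternatingMap, e3]
    ext u
    simp
  have h2 : AlternatingMap.alternatizeUncurryFin W₂ = 0 := by
    obtain ⟨e, he⟩ := alternatizeUncurryFin_wedge_right α (curvatureDeriv cov hcov x w) W₂
      fun _ => rfl
    rw [he, alternatizeUncurryFin_curvatureDeriv, wedge_zero_right]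
    rfl
  have h3 : covExtDeriv cov (starCurvature g o cov hcov) x v w =
      c • (AlternatingMap.alternatizeUncurryFin W₁ v +
        AlternatingMap.alternatizeUncurryFin W₂ v) := by
    rw [AlternatingMap.alternatizeUncurryFin_apply, AlternatingMap.alternatizeUncurryFin_apply,
      ← Finset.sum_add_distrib, Finset.smul_sum]
    refine Finset.sum_congr rfl fun i _ => ?_
    have h4 := covEnd_starCurvature g o cov hcov Ω hη hc (v i) (i.removeNth v) w
    refine (congrArg (fun t => (-1 : ℝ) ^ (i : ℕ) • t) h4).trans ?_
    rw [← smul_add, smul_comm c, ← Int.cast_smul_eq_zsmul ℝ]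
    push_cast
    rfl
  rw [h3, h1, h2]
  simp

end SelfDual

end YMForms

theorem mainTheorem2 {m : ℕ} {M : Type*} [TopologicalSpace M] [T2Space M]
    [ChartedSpace (EuclideanSpace ℝ (Fin (m + 4))) M] [IsManifold (𝓡 (m + 4)) ∞ M]
    (g : YMForms.PseudoRiemannianMetric (m + 4) M) (o : YMForms.ManifoldOrientation (m + 4) M)
    {F : Type*} [NormedAddCommGroup F] [NormedSpace ℝ F] [FiniteDimensional ℝ F]
    {V : M → Type*} [TopologicalSpace (TotalSpace F V)]
    [∀ x, AddCommGroup (V x)] [∀ x, Module ℝ (V x)] [∀ x, TopologicalSpace (V x)]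
    [∀ x, IsTopologicalAddGroup (V x)] [∀ x, ContinuousSMul ℝ (V x)]
    [FiberBundle F V] [VectorBundle ℝ F V] [ContMDiffVectorBundle ∞ F V (𝓡 (m + 4))]
    (Ω : YMForms.FormField (m + 4) M 4) (hΩ : YMForms.IsSmoothForm Ω)
    (hΩ_app : YMForms.IsAppropriate g o Ω) (μ : ℝ) (hμ : μ ≠ 0)
    (cov : CovariantDerivative (𝓡 (m + 4)) F V)
    (hcov : CovariantDerivative.ContMDiffCovariantDerivative cov ∞)
    (hsd : YMForms.IsSelfDual g o Ω μ cov hcov) :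
    YMForms.IsYangMills g o cov hcov :=
  YMForms.isYangMills_of_selfDual g o cov hcov Ω hΩ hμ hsd
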